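/- Let $p$ be an odd prime, let $F$ be a field, and let $A$ be a central division $F$-algebra of degree $p^{2}$ (so $[A:F]=p^{4}$) containing a Galois extension $K/F$ of degree $p$. Suppose there are two discrete valuations $v_1,v_2$ of $F$ such that: 1. $v_1$ and $v_2$ extend to valuations of $A$; 2. $K/F$ is totally ramified for $v_1$, $\operatorname{char}\overline{F}_{v_1}\neq p$, and $\overline{F}_{v_1}$ contains no primitive $(p^{2})$-th root of unity; 3. $K/F$ is inertial for $v_2$ (the residue field extension is separable of degree $[K:F]$), $\overline{F}_{v_2}$ is finite, and $|\overline{F}_{v_2}|\not\equiv 0,1 \pmod p$. Here $\overline{F}_{v_i}$ is the residue field of $F$ for $v_i$, and $K$ is valued by the restriction of the extension of $v_i$ to $A$. Then $A$ has no maximal subfield $M$ containing $K$ such that $M/F$ is a Galois extension. Consequently, let $\Gamma$ be any totally ordered abelian group, let $\varepsilon:\Gamma\to G:=\operatorname{Gal}(K/F)$ be any surjective homomorphism, and choose for each $\sigma\in G$ any $u_\sigma\in A^{\times}$ with $\sigma(x)=u_\sigma^{-1}xu_\sigma$ for all $x\in K$, where $u_{\mathrm{Id}}=1$. Let $\mathcal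 D=C_A(K)((\Gamma))$ be the Mal'cev–Neumann ring: its elements are the formal series $\sum_{\gamma\in\Gamma}a_\gamma r_\gamma$ with well-ordered support and coefficients $r_\gamma$ in the centralizer $C_A(K)$ of $K$ in $A$, with componentwise addition and with multiplication given by $$ra_\gamma=a_\gamma\,(u_{\varepsilon(\gamma)}^{-1}\,r\,u_{\varepsilon(\gamma)}),\qquad a_\gamma a_\delta=a_{\gamma+\delta}\,u_{\varepsilon(\gamma)\varepsilon(\delta)}^{-1}\,u_{\varepsilon(\gamma)}\,u_{\varepsilon(\delta)}$$ for $r\in C_A(K)$ and $\gamma,\delta\in\Gamma$. Then $\mathcal D$ is a noncrossed product division algebra: it is a division algebra, finite-dimensional over its centre $F((\ker\varepsilon))$ (the series $\sum_{\gamma\in\ker\varepsilon}a_\gamma c_\gamma$ with $c_\gamma\in F$), and it contains no maximal commutative subalgebra that is a Galois field extension of this centre. -/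

import Mathlib

set_option linter.unusedSectionVars false

/-! ### Subfields of an algebra and crossed products -/

section CrossedProducts

variable {F A : Type*} [Field F] [Ring A] [Algebra F A]

/-- A subalgebra `M` of an `F`-algebra is a Galois field extension of `F`. -/
def Subalgebra.IsGaloisField (M : Subalgebra F A) : Prop :=
  ∃ h : IsField M, letI := h.toField; IsGalois F M

/-- `M` is a maximal subfield of `A`: a subalgebra that is a field, maximal among the
subalgebras that are fields. -/
def Subalgebra.IsMaximalSubfield (M : Subalgebra F A) : Prop :=
  Maximal (fun N : Subalgebra F A => IsField N) M

/-- `M` is a maximal commutative subalgebra of `A`. -/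
def Subalgebra.IsMaximalCommutative (M : Subalgebra F A) : Prop :=
  Maximal (fun N : Subalgebra F A => ∀ x ∈ N, ∀ y ∈ N, x * y = y * x) M

variable (F A)

/-- The finite-dimensional central simple `F`-algebra `A` is a crossed product: it contains a
maximal commutative subalgebra that is a Galois field extension of `F`. -/
def IsCrossedProduct : Prop :=
  ∃ M : Subalgebra F A, M.IsMaximalCommutative ∧ M.IsGaloisField

/-- `A` is a noncrossed product division algebra with centre `F`: a division algebra,
finite-dimensional over its centre `F`, that is not a crossed product. -/
structure IsNoncrossedProductDivisionAlgebra : Prop where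
  nontrivial : Nontrivial A
  exists_inv : ∀ x : A, x ≠ 0 → ∃ y : A, x * y = 1 ∧ y * x = 1
  isCentral : Algebra.IsCentral F A
  finite : Module.Finite F A
  not_isCrossedProduct : ¬ IsCrossedProduct F A

end CrossedProducts

/-! ### Ramification of valuations -/

section Ramification

variable {F K A Λ Λ' : Type*} [Field F] [Field K] [Algebra F K] [Ring A] [Algebra F A]
  [LinearOrderedCommGroupWithZero Λ] [LinearOrderedCommGroupWithZero Λ']

/-- If `w` is a valuation of an `F`-algebra `A` extending `v`, then the restriction of `w` to a
subfield `K` of `A` extends `v`. -/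
instance Valuation.HasExtension.comapAlgHom (v : Valuation F Λ) (w : Valuation A Λ')
    [v.HasExtension w] (ι : K →ₐ[F] A) : v.HasExtension (w.comap (ι : K →+* A)) where
  val_isEquiv_comap := by
    have h : (w.comap (ι : K →+* A)).comap (algebraMap F K) = w.comap (algebraMap F A) := by
      ext x
      simp
    rw [h]
    exact Valuation.HasExtension.val_isEquiv_comap

/-- The ramification index of a valuation `w` of `K` over the subfield `F`: the index of the value
group `w(Fˣ)` in the value group `w(Kˣ)` (`0` if infinite). -/
noncomputable def Valuation.ramificationIndex (F : Type*) [Field F] [Algebra F K]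
    (w : Valuation K Λ') : ℕ :=
  (MonoidWithZeroHom.valueGroup (.ofClass (w.comap (algebraMap F K)))).relIndex
    (MonoidWithZeroHom.valueGroup (.ofClass w))

/-- The valued field extension `(K, w)/(F, w|_F)` is totally ramified: its ramification index
is `[K : F]`. -/
def Valuation.IsTotallyRamified (F : Type*) [Field F] [Algebra F K] (w : Valuation K Λ') : Prop :=
  w.ramificationIndex F = Module.finrank F K

/-- The residue field of a valuation. -/
abbrev Valuation.Residue (v : Valuation F Λ) : Type _ :=
  IsLocalRing.ResidueField v.valuationSubring

/-- The valued field extension `(K, w)/(F, v)` is inertial: the residue field extension is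
separable of degree `[K : F]`. -/
def Valuation.IsInertial (v : Valuation F Λ) (w : Valuation K Λ') [v.HasExtension w] : Prop :=
  Algebra.IsSeparable v.Residue w.Residue ∧
    Module.finrank v.Residue w.Residue = Module.finrank F K

end Ramification

/-! ### Mal'cev-Neumann rings -/

section MalcevNeumann

/-- The data needed to form the Mal'cev-Neumann ring `C_A(K)((Γ))`, where `ι` embeds the Galois
extension `K` of `F` into the `F`-algebra `A` and `Γ` is an abelian group: a surjective
homomorphism `ε : Γ → Gal(K/F)`, and for all `σ` in `Gal(K/F)` a unit `u σ` of `A` with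
`σ x = (u σ)⁻¹ x (u σ)` for all `x` in `K`, where `u 1 = 1`. -/
structure MalcevNeumannDatum {F K A : Type*} [Field F] [Field K] [Algebra F K] [Ring A]
    [Algebra F A] (ι : K →ₐ[F] A) (Γ : Type*) [AddCommGroup Γ] where
  ε : Γ →+ Additive (K ≃ₐ[F] K)
  ε_surjective : Function.Surjective ε
  u : (K ≃ₐ[F] K) → Aˣ
  u_one : u 1 = 1
  conj_u : ∀ σ x, ι (σ x) = ↑(u σ)⁻¹ * ι x * ↑(u σ)

variable {F K A : Type*} [Field F] [Field K] [Algebra F K] [Ring A] [Algebra F A]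
  {ι : K →ₐ[F] A} {Γ : Type*} [AddCommGroup Γ]

/-- The centralizer `C_A(K)` of `K` in `A`. -/
abbrev centralizerOf (ι : K →ₐ[F] A) : Subalgebra F A :=
  Subalgebra.centralizer F (Set.range ι)

namespace MalcevNeumannDatum

variable (d : MalcevNeumannDatum ι Γ)

/-- The automorphism `ε(γ)` of `K`. -/
def aut (γ : Γ) : K ≃ₐ[F] K := (d.ε γ).toMul

/-- The unit `u_{ε(γ)}` of `A`. -/
def unit (γ : Γ) : Aˣ := d.u (d.aut γ)

lemma aut_add (γ δ : Γ) : d.aut (γ + δ) = d.aut γ * d.aut δ := by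
  simp [aut]

lemma aut_add' (γ δ : Γ) : d.aut (γ + δ) = d.aut δ * d.aut γ := by
  rw [add_comm, aut_add]

lemma aut_zero : d.aut 0 = 1 := by
  simp [aut]

lemma unit_of_aut_eq_one {γ : Γ} (h : d.aut γ = 1) : d.unit γ = 1 := by
  rw [unit, h, d.u_one]

lemma map_mul_unit (γ : Γ) (x : K) : ι x * d.unit γ = d.unit γ * ι (d.aut γ x) := by
  rw [unit, d.conj_u, ← mul_assoc, ← mul_assoc, Units.mul_inv, one_mul]

lemma unit_inv_mul_map (γ : Γ) (x : K) :
    (↑(d.unit γ)⁻¹ : A) * ι x = ι (d.aut γ x) * ↑(d.unit γ)⁻¹ := by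
  rw [unit, d.conj_u, mul_assoc, Units.mul_inv, mul_one]

/-- The automorphism `r ↦ u_{ε(γ)}⁻¹ r u_{ε(γ)}` of `C_A(K)`. -/
def twist (γ : Γ) (r : centralizerOf ι) : centralizerOf ι :=
  ⟨↑(d.unit γ)⁻¹ * r * ↑(d.unit γ), by
    rw [Subalgebra.mem_centralizer_iff]
    rintro _ ⟨x, rfl⟩
    obtain ⟨y, rfl⟩ := (d.aut γ).surjective x
    have hr : ι y * r = r * ι y :=
      (Subalgebra.mem_centralizer_iff F).1 r.2 (ι y) ⟨y, rfl⟩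
    rw [← mul_assoc, ← mul_assoc, ← unit_inv_mul_map, mul_assoc _ (ι y), hr, mul_assoc _ _
      (ι (d.aut γ y)), ← map_mul_unit]
    simp only [mul_assoc]⟩

/-- The element `u_{ε(γ)ε(δ)}⁻¹ u_{ε(γ)} u_{ε(δ)}` of `C_A(K)`. -/
def cocycle (γ δ : Γ) : centralizerOf ι :=
  ⟨↑(d.unit (γ + δ))⁻¹ * ↑(d.unit γ) * ↑(d.unit δ), by
    rw [Subalgebra.mem_centralizer_iff]
    rintro _ ⟨x, rfl⟩
    obtain ⟨y, rfl⟩ := (d.aut (γ + δ)).surjective x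
    rw [← mul_assoc, ← mul_assoc, ← unit_inv_mul_map, mul_assoc _ (ι y), map_mul_unit,
      ← mul_assoc, mul_assoc _ (ι _), map_mul_unit, aut_add']
    simp only [mul_assoc, AlgEquiv.mul_apply]⟩

end MalcevNeumannDatum

variable [LinearOrder Γ]

/-- The Mal'cev-Neumann ring `C_A(K)((Γ))`: its elements are the formal series `∑ a_γ r_γ` with
coefficients `r_γ` in `C_A(K)` and well-ordered support in `Γ`. The ring structure is the
one generated by `r a_γ = a_γ (u_{ε(γ)}⁻¹ r u_{ε(γ)})` and
`a_γ a_δ = a_{γ+δ} u_{ε(γ)ε(δ)}⁻¹ u_{ε(γ)} u_{ε(δ)}`; see `MalcevNeumannRing.instMul`. -/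
def MalcevNeumannRing (_d : MalcevNeumannDatum ι Γ) : Type _ :=
  HahnSeries Γ (centralizerOf ι)

namespace MalcevNeumannRing

open MalcevNeumannDatum

variable (d : MalcevNeumannDatum ι Γ)

noncomputable instance instAddCommGroup : AddCommGroup (MalcevNeumannRing d) :=
  inferInstanceAs (AddCommGroup (HahnSeries Γ (centralizerOf ι)))

variable {d}

/-- The coefficient `r_γ` of the series `∑ a_γ r_γ`. -/
def coeff (f : MalcevNeumannRing d) (γ : Γ) : centralizerOf ι := HahnSeries.coeff f γ

/-- The support of a series. -/
def supp (f : MalcevNeumannRing d) : Set Γ := {γ | f.coeff γ ≠ 0}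

lemma isPWO_supp (f : MalcevNeumannRing d) : f.supp.IsPWO := HahnSeries.isPWO_support f

lemma ext_coeff {f g : MalcevNeumannRing d} (h : ∀ γ, f.coeff γ = g.coeff γ) : f = g :=
  HahnSeries.ext (funext h)

lemma coeff_add (f g : MalcevNeumannRing d) (γ : Γ) :
    (f + g).coeff γ = f.coeff γ + g.coeff γ := rfl

/-- The unit element is `a_0`. -/
noncomputable instance instOne : One (MalcevNeumannRing d) :=
  ⟨HahnSeries.single 0 (1 : centralizerOf ι)⟩

lemma coeff_zero (γ : Γ) : (0 : MalcevNeumannRing d).coeff γ = 0 := rfl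

/-- The series `∑ u_{ε(γ)} r_γ t^γ` with coefficients in `A` attached to `∑ a_γ r_γ`; it is used to
verify the ring axioms. -/
noncomputable def toHahn (f : MalcevNeumannRing d) : HahnSeries Γ A where
  coeff γ := d.unit γ * (f.coeff γ : A)
  isPWO_support' := f.isPWO_supp.mono fun γ hγ h => hγ (by simp [h])

lemma toHahn_coeff (f : MalcevNeumannRing d) (γ : Γ) :
    f.toHahn.coeff γ = d.unit γ * (f.coeff γ : A) := rfl

lemma toHahn_injective : Function.Injective (toHahn (d := d)) := fun f g h =>
  ext_coeff fun γ => Subtype.ext <| by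
    have := congrArg (fun x => HahnSeries.coeff x γ) h
    simpa [toHahn_coeff] using this

lemma support_toHahn (f : MalcevNeumannRing d) : f.toHahn.support = f.supp := by
  ext γ
  simp [toHahn_coeff, supp]

lemma toHahn_zero : (0 : MalcevNeumannRing d).toHahn = 0 := by
  ext γ
  simp [toHahn_coeff, coeff_zero]

lemma toHahn_add (f g : MalcevNeumannRing d) : (f + g).toHahn = f.toHahn + g.toHahn := by
  ext γ
  simp [toHahn_coeff, coeff_add, mul_add]

lemma toHahn_one : (1 : MalcevNeumannRing d).toHahn = 1 := by
  ext γ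
  have h : (1 : MalcevNeumannRing d).coeff γ =
    (HahnSeries.single 0 (1 : centralizerOf ι)).coeff γ := rfl
  rw [toHahn_coeff, h, HahnSeries.coeff_one, HahnSeries.coeff_single]
  split_ifs with h0
  · simp [h0, d.unit_of_aut_eq_one d.aut_zero]
  · simp

variable [IsOrderedAddMonoid Γ]

/-- The product of `∑ a_α r_α` and `∑ a_β s_β`. Its coefficient at `γ` is the sum, over all
`α` and `β` in the supports with `α + β = γ`, of
`(u_{ε(α)ε(β)}⁻¹ u_{ε(α)} u_{ε(β)}) (u_{ε(β)}⁻¹ r_α u_{ε(β)}) s_β`. -/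
noncomputable instance instMul : Mul (MalcevNeumannRing d) :=
  ⟨fun f g => HahnSeries.mk
    (fun γ => ∑ p ∈ Finset.antidiagonal f.isPWO_supp g.isPWO_supp γ,
      d.cocycle p.1 p.2 * d.twist p.2 (f.coeff p.1) * g.coeff p.2)
    (Set.IsPWO.mono (Finset.isPWO_support_antidiagonal (hs := f.isPWO_supp)
      (ht := g.isPWO_supp)) fun γ hγ => by
        by_contra h
        refine hγ (Finset.sum_eq_zero fun p hp => ?_)
        exact absurd ⟨p, hp⟩ h)⟩

lemma coeff_mul (f g : MalcevNeumannRing d) (γ : Γ) :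
    (f * g).coeff γ = ∑ p ∈ Finset.antidiagonal f.isPWO_supp g.isPWO_supp γ,
      d.cocycle p.1 p.2 * d.twist p.2 (f.coeff p.1) * g.coeff p.2 := rfl

lemma toHahn_mul (f g : MalcevNeumannRing d) : (f * g).toHahn = f.toHahn * g.toHahn := by
  ext γ
  rw [toHahn_coeff, coeff_mul, HahnSeries.coeff_mul]
  simp only [support_toHahn, toHahn_coeff]
  push_cast
  rw [Finset.mul_sum]
  refine Finset.sum_congr rfl fun p hp => ?_
  obtain ⟨-, -, rfl⟩ := Finset.mem_antidiagonal.1 hp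
  simp only [cocycle, twist, mul_assoc, Units.mul_inv_cancel_left]

noncomputable instance instRing : Ring (MalcevNeumannRing d) :=
  { instAddCommGroup d, instOne (d := d), instMul (d := d) with
    left_distrib := fun f g h => toHahn_injective <| by
      simp only [toHahn_mul, toHahn_add, mul_add]
    right_distrib := fun f g h => toHahn_injective <| by
      simp only [toHahn_mul, toHahn_add, add_mul]
    zero_mul := fun f => toHahn_injective <| by simp only [toHahn_mul, toHahn_zero, zero_mul]
    mul_zero := fun f => toHahn_injective <| by simp only [toHahn_mul, toHahn_zero, mul_zero]
    mul_assoc := fun f g h => toHahn_injective <| by simp only [toHahn_mul, mul_assoc]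
    one_mul := fun f => toHahn_injective <| by simp only [toHahn_mul, toHahn_one, one_mul]
    mul_one := fun f => toHahn_injective <| by simp only [toHahn_mul, toHahn_one, mul_one] }

/-- The series `∑ a_γ c_γ` of `F((ker ε))`, where `γ` runs over `ker ε` and the `c_γ` are in `F`,
as an element of `C_A(K)((Γ))`. -/
noncomputable def ofKer (c : HahnSeries d.ε.ker F) : MalcevNeumannRing d :=
  HahnSeries.embDomain (OrderEmbedding.subtype fun γ => γ ∈ d.ε.ker)
    (c.map (algebraMap F (centralizerOf ι)))

lemma coeff_ofKer (c : HahnSeries d.ε.ker F) (γ : d.ε.ker) :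
    (ofKer c).coeff γ = algebraMap F (centralizerOf ι) (c.coeff γ) :=
  HahnSeries.embDomain_coeff (f := OrderEmbedding.subtype fun γ => γ ∈ d.ε.ker)

lemma coeff_ofKer_of_notMem (c : HahnSeries d.ε.ker F) {γ : Γ} (h : γ ∉ d.ε.ker) :
    (ofKer c).coeff γ = 0 :=
  HahnSeries.embDomain_of_notMem_range (by simpa using h)

lemma toHahn_ofKer (c : HahnSeries d.ε.ker F) :
    (ofKer c).toHahn = HahnSeries.embDomainRingHom d.ε.ker.subtype d.ε.ker.subtype_injective
      (fun _ _ => Iff.rfl) (c.map (algebraMap F A)) := by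
  ext γ
  rw [toHahn_coeff]
  by_cases h : γ ∈ d.ε.ker
  · lift γ to d.ε.ker using h
    rw [coeff_ofKer, d.unit_of_aut_eq_one (by
      have := γ.2
      rw [AddMonoidHom.mem_ker] at this
      simp [aut, this])]
    refine Eq.trans ?_ (HahnSeries.embDomain_coeff (a := γ)).symm
    simp
  · rw [coeff_ofKer_of_notMem c h]
    refine Eq.trans (by simp) (HahnSeries.embDomain_of_notMem_range ?_).symm
    simpa using h

/-- The inclusion of `F((ker ε))` in `C_A(K)((Γ))`. -/
noncomputable def kerHom (d : MalcevNeumannDatum ι Γ) :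
    HahnSeries d.ε.ker F →+* MalcevNeumannRing d where
  toFun := ofKer
  map_one' := toHahn_injective <| by
    have h : (1 : HahnSeries d.ε.ker F).map (algebraMap F A) = 1 := by
      ext γ
      rw [HahnSeries.map_coeff, HahnSeries.coeff_one, HahnSeries.coeff_one]
      split_ifs <;> simp
    rw [toHahn_ofKer, toHahn_one, h, map_one]
  map_mul' c c' := toHahn_injective <| by
    rw [toHahn_mul, toHahn_ofKer, toHahn_ofKer, toHahn_ofKer, ← map_mul]
    exact congrArg _ (HahnSeries.map_mul (algebraMap F A : F →ₙ+* A))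
  map_zero' := toHahn_injective <| by
    have h : (0 : HahnSeries d.ε.ker F).map (algebraMap F A) = 0 := by
      ext γ
      simp
    rw [toHahn_ofKer, toHahn_zero, h, map_zero]
  map_add' c c' := toHahn_injective <| by
    have h : (c + c').map (algebraMap F A) =
        c.map (algebraMap F A) + c'.map (algebraMap F A) := by
      ext γ
      simp
    rw [toHahn_add, toHahn_ofKer, toHahn_ofKer, toHahn_ofKer, ← map_add, h]

lemma kerHom_commutes (c : HahnSeries d.ε.ker F) (f : MalcevNeumannRing d) :
    kerHom d c * f = f * kerHom d c := by
  apply toHahn_injective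
  rw [toHahn_mul, toHahn_mul]
  ext γ
  rw [HahnSeries.coeff_mul, HahnSeries.coeff_mul]
  refine Finset.sum_bij (fun p _ => p.swap) (fun p hp => ?_) (fun p _ q _ h => ?_)
    (fun p hp => ⟨p.swap, ?_, ?_⟩) (fun p hp => ?_)
  · simpa [and_left_comm, add_comm] using hp
  · simpa using h
  · simpa [and_left_comm, add_comm] using hp
  · simp
  · have h : (kerHom d c).toHahn.coeff p.1 ∈ Set.range (algebraMap F A) := by
      change (ofKer c).toHahn.coeff p.1 ∈ _
      by_cases h : p.1 ∈ d.ε.ker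
      · refine ⟨c.coeff ⟨p.1, h⟩, ?_⟩
        rw [toHahn_coeff, coeff_ofKer c ⟨p.1, h⟩, d.unit_of_aut_eq_one
          (by rw [AddMonoidHom.mem_ker] at h; simp [aut, h])]
        simp
      · refine ⟨0, ?_⟩
        rw [toHahn_coeff, coeff_ofKer_of_notMem c h]
        simp
    obtain ⟨x, hx⟩ := h
    simp only [Prod.fst_swap, Prod.snd_swap, ← hx, Algebra.commutes]

/-- `C_A(K)((Γ))` as an algebra over `F((ker ε))`. -/
noncomputable instance instAlgebra : Algebra (HahnSeries d.ε.ker F) (MalcevNeumannRing d) :=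
  (kerHom d).toAlgebra' kerHom_commutes

end MalcevNeumannRing

end MalcevNeumann

/-! Both assertions rest on the tame character `g • x / x`, taken modulo the maximal ideal, of a
group acting on a valued field and preserving the valuation. For `g` in the inertia group (acting
trivially on the residue field) it depends only on the value of `x` and is multiplicative in `g` and
in `x`. If the order of `g` is invertible in the residue field, triviality of its character on all
nonzero `x` forces `g` to act trivially.

Suppose `M ⊇ K` is Galois of degree `p ^ 2` over `F` inside `A`. Valuations of `A` restrict to
Galois-invariant valuations of `M`, because automorphisms are realized elementwise by conjugation in
`A` and value groups are commutative. The group has order `p ^ 2`, so two cases arise. If it is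
cyclic, total ramification of `K` at `v₁` makes the whole group inertia, and a generator has a
character value of order `p ^ 2` that descends to the residue field of `F`
(`exists_isPrimitiveRoot_of_isCyclic`). If it is not cyclic, it cannot act faithfully on a finite
residue field at `v₂`, so inertia is nontrivial and gives a nontrivial `p`-th root of unity there,
whence the residue field has `1` modulo `p` elements (`card_residue_modEq_one`). Both are excluded.

For the Mal'cev–Neumann ring, sending `a_γ` to `u_{ε(γ)} t ^ γ` embeds it in the untwisted Hahn
series over `A`. This gives a domain of dimension `p ^ 4` over its centre `F((ker ε))`, valued by
the order of series. A maximal commutative Galois subfield `M` then has degree `p ^ 2`. Its residue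
field is Galois over `F` and embeds in `C_A(K)` by constant coefficients, so its compositum with `K`
is a Galois subfield of `A` containing `K`. By the first half that compositum has degree `p`, so the
residue field lies in `K`. This is impossible (`not_residueAlgHom_range_le`): some element of `M`
would have order outside `ker ε`, which forces the residue field down to `F`, and the tame character
of that element would embed a group of order `p ^ 2` in the `p`-th roots of unity. -/

section

/-! ### Tame characters of invariant valuations -/

open IsLocalRing

/-- A valuation is invariant under the action of a group. -/
class Valuation.IsInvariant (G : Type*) {M Λ : Type*} [Field M] [LinearOrderedCommGroupWithZero Λ]
    [Group G] [MulSemiringAction G M] (w : Valuation M Λ) : Prop where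
  map_smul : ∀ (g : G) (x : M), w (g • x) = w x

namespace Valuation

variable {G M Λ : Type*} [Field M] [LinearOrderedCommGroupWithZero Λ]
    [Group G] [MulSemiringAction G M] (w : Valuation M Λ) [w.IsInvariant G]

/-- The action of a group on the valuation ring of an invariant valuation. -/
instance : MulSemiringAction G w.valuationSubring where
  smul g x := ⟨g • (x : M), by
    rw [mem_valuationSubring_iff, IsInvariant.map_smul]; exact x.2⟩
  one_smul x := Subtype.ext (one_smul G (x : M))
  mul_smul g h x := Subtype.ext (mul_smul g h (x : M))
  smul_zero g := Subtype.ext (smul_zero g)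
  smul_add g x y := Subtype.ext (smul_add g (x : M) y)
  smul_one g := Subtype.ext (smul_one g)
  smul_mul g x y := Subtype.ext (MulSemiringAction.smul_mul g (x : M) y)

lemma coe_smul_valuationSubring (g : G) (x : w.valuationSubring) :
    ((g • x : w.valuationSubring) : M) = g • (x : M) := rfl

variable {w} in
lemma residue_eq_zero_iff (x : w.valuationSubring) : residue _ x = 0 ↔ w x < 1 := by
  rw [IsLocalRing.residue_eq_zero_iff]
  exact mem_maximalIdeal_iff _ w

variable {w} in
lemma residue_ne_zero_iff (x : w.valuationSubring) : residue _ x ≠ 0 ↔ w x = 1 := by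
  rw [Ne, residue_eq_zero_iff, not_lt]
  exact ⟨fun h => le_antisymm x.2 h, fun h => h.ge⟩

/-- The class of `g x / x` in the residue field. -/
noncomputable def tameChar (g : G) (x : M) : w.Residue :=
  residue w.valuationSubring ⟨g • x / x, by
    rw [mem_valuationSubring_iff, map_div₀, IsInvariant.map_smul]
    exact div_self_le_one _⟩

lemma tameChar_mul (g : G) (x y : M) : w.tameChar g (x * y) = w.tameChar g x * w.tameChar g y := by
  rw [tameChar, tameChar, tameChar, ← map_mul]
  congr 1
  ext
  simp only [smul_mul', MulMemClass.mk_mul_mk]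
  exact mul_div_mul_comm _ _ _ _

lemma tameChar_one (g : G) : w.tameChar g (1 : M) = 1 := by
  rw [tameChar, ← map_one (residue _)]
  congr 1
  ext
  simp

lemma tameChar_pow (g : G) (x : M) (n : ℕ) : w.tameChar g (x ^ n) = w.tameChar g x ^ n := by
  induction n with
  | zero => simp [tameChar_one]
  | succ n ih => rw [pow_succ, pow_succ, tameChar_mul, ih]

lemma tameChar_ne_zero (g : G) {x : M} (hx : x ≠ 0) : w.tameChar g x ≠ 0 := by
  rw [tameChar, residue_ne_zero_iff]
  simp [IsInvariant.map_smul, hx]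

variable {w} in
lemma tameChar_of_fixed {g : G} {x : M} (hx : x ≠ 0) (h : g • x = x) : w.tameChar g x = 1 := by
  rw [tameChar, ← map_one (residue _)]
  congr 1
  ext
  simp [h, hx]

lemma tameChar_one_left {x : M} (hx : x ≠ 0) : w.tameChar (1 : G) x = 1 :=
  tameChar_of_fixed hx (one_smul _ _)

/-- Only a cocycle identity in general; it becomes multiplicativity in the group variable once
`tameChar_congr` allows `h • x` to be replaced by `x`. -/
lemma tameChar_mul_left (g h : G) {x : M} (hx : x ≠ 0) :
    w.tameChar (g * h) x = w.tameChar g (h • x) * w.tameChar h x := by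
  rw [tameChar, tameChar, tameChar, ← map_mul]
  congr 1
  ext
  have : h • x ≠ 0 := (smul_ne_zero_iff_ne h).2 hx
  simp only [mul_smul, MulMemClass.mk_mul_mk]
  field_simp

variable {w} in
lemma tameChar_of_val_eq_one {g : G} (hg : ∀ y : w.Residue, g • y = y) {x : M} (hx : w x = 1) :
    w.tameChar g x = 1 := by
  have hx0 : x ≠ 0 := by rintro rfl; simp at hx
  let y : w.valuationSubring := ⟨x, hx.le⟩
  have hy : residue _ y ≠ 0 := (residue_ne_zero_iff y).2 hx
  have h : w.tameChar g x * residue _ y = residue _ (g • y) := by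
    rw [tameChar, ← map_mul]
    congr 1
    ext
    exact div_mul_cancel₀ _ hx0
  refine mul_right_cancel₀ hy ?_
  rw [one_mul, h, ResidueField.residue_smul, hg]

variable {w} in
-- Elements of equal value differ by a unit, and an inertia element fixes the residue of a unit.
lemma tameChar_congr {g : G} (hg : ∀ y : w.Residue, g • y = y) {x y : M} (hx : x ≠ 0)
    (h : w x = w y) : w.tameChar g x = w.tameChar g y := by
  have hy : w (y / x) = 1 := by
    rw [map_div₀, h, div_self]
    rw [← h]
    simpa using hx
  rw [← div_mul_cancel₀ y hx, tameChar_mul, tameChar_of_val_eq_one hg hy, one_mul]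

variable {w} in
lemma tameChar_pow_left {g : G} (hg : ∀ y : w.Residue, g • y = y) {x : M} (hx : x ≠ 0) (n : ℕ) :
    w.tameChar (g ^ n) x = w.tameChar g x ^ n := by
  induction n with
  | zero => simp [tameChar_one_left w hx]
  | succ n ih =>
    rw [pow_succ', pow_succ', tameChar_mul_left w _ _ hx, ih, tameChar_congr hg
      ((smul_ne_zero_iff_ne (g ^ n)).2 hx) (IsInvariant.map_smul (g ^ n) x)]

variable {w} in
-- Since `h` and `g` commute, `h` carries `g • x / x` to `g • (h • x) / (h • x)`, and `h • x` has
-- the same value as `x`. This is what lets character values descend to the base field.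
lemma smul_tameChar {g : G} (hg : ∀ y : w.Residue, g • y = y) {h : G} (hh : Commute h g) {x : M}
    (hx : x ≠ 0) : h • w.tameChar g x = w.tameChar g x := by
  conv_rhs => rw [← tameChar_congr hg ((smul_ne_zero_iff_ne h).2 hx) (IsInvariant.map_smul h x)]
  rw [tameChar, ← ResidueField.residue_smul, tameChar]
  congr 1
  ext
  simp only [coe_smul_valuationSubring, smul_div₀', smul_smul, hh.eq]

variable {w} in
/-- An automorphism of finite order prime to the residue characteristic with trivial tame character
is trivial. -/
lemma smul_eq_of_tameChar_eq_one {g : G} {n : ℕ} (hn : g ^ n = 1) (hn0 : (n : w.Residue) ≠ 0)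
    (h : ∀ x ≠ 0, w.tameChar g x = 1) (y : M) : g • y = y := by
  by_contra hy
  have hx : g • y - y ≠ 0 := sub_ne_zero.2 hy
  -- The sum of `g ^ i • x` over `i < n` telescopes to zero, while after division by `x` every term
  -- has residue `1`; so `n` would vanish in the residue field.
  set x := g • y - y with hxdef
  have hpow (i : ℕ) : w.tameChar (g ^ i) x = 1 := by
    induction i with
    | zero => simp [tameChar_one_left w hx]
    | succ i ih =>
      rw [pow_succ', tameChar_mul_left w _ _ hx, ih, h _ ((smul_ne_zero_iff_ne (g ^ i)).2 hx),
        one_mul]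
  have hsum : ∑ i ∈ Finset.range n, g ^ i • x = 0 := by
    simp only [hxdef, smul_sub, smul_smul, ← pow_succ]
    rw [Finset.sum_range_sub (fun i => g ^ i • y), hn, pow_zero, sub_self]
  apply hn0
  calc (n : w.Residue) = ∑ i ∈ Finset.range n, w.tameChar (g ^ i) x := by simp [hpow]
    _ = 0 := by
      simp only [tameChar]
      rw [← map_sum, ← map_zero (residue w.valuationSubring)]
      congr 1
      ext
      push_cast
      rw [← Finset.sum_div, hsum, zero_div]

variable (G) {w}

/-- If a finite group acts faithfully on the residue field then the value group is that of the
fixed field. -/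
lemma exists_fixed_val_eq [Finite G] [FaithfulSMul G w.Residue] (x : M) :
    ∃ z : M, (∀ g : G, g • z = z) ∧ w z = w x := by
  classical
  by_cases hx : x = 0
  · exact ⟨0, by simp, by simp [hx]⟩
  have := Fintype.ofFinite G
  have hinj : Function.Injective fun g : G =>
      ((MulSemiringAction.toRingHom G w.Residue g : w.Residue →+* w.Residue) :
        w.Residue →* w.Residue) := fun g h hgh =>
    FaithfulSMul.eq_of_smul_eq_smul (α := w.Residue) fun y => congrArg (fun f => f y) hgh
  -- Dedekind independence of the residue automorphisms yields `y` for which the trace of `y * x` is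
  -- `x` times a unit.
  have hli := (linearIndependent_monoidHom w.Residue w.Residue).comp _ hinj
  rw [Fintype.linearIndependent_iff] at hli
  have hne : ∃ y : w.Residue, ∑ g : G, w.tameChar g x * g • y ≠ 0 := by
    by_contra! hy
    refine w.tameChar_ne_zero (1 : G) hx (hli (fun g => w.tameChar g x) ?_ 1)
    ext y
    simpa using hy y
  obtain ⟨y, hy⟩ := hne
  obtain ⟨y, rfl⟩ := residue_surjective y
  refine ⟨∑ g : G, g • ((y : M) * x), fun g => ?_, ?_⟩
  · rw [Finset.smul_sum]
    simp only [smul_smul]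
    exact Equiv.sum_comp (Equiv.mulLeft g) fun h => h • ((y : M) * x)
  · simp only [tameChar, ← ResidueField.residue_smul] at hy
    simp only [← map_mul] at hy
    rw [← map_sum, residue_ne_zero_iff] at hy
    push_cast at hy
    simp only [coe_smul_valuationSubring] at hy
    have : ∑ g : G, g • ((y : M) * x) = (∑ g : G, g • x / x * g • (y : M)) * x := by
      rw [Finset.sum_mul]
      refine Finset.sum_congr rfl fun g _ => ?_
      rw [smul_mul']
      field_simp
    rw [this, map_mul, hy, one_mul]

/-- If the order of a finite group is prime to the residue characteristic then the fixed elements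
of the residue field lift to fixed elements. -/
lemma exists_fixed_residue_eq [Finite G] (hG : (Nat.card G : w.Residue) ≠ 0) (y : w.Residue)
    (hy : ∀ g : G, g • y = y) :
    ∃ z : w.valuationSubring, (∀ g : G, g • z = z) ∧ residue _ z = y := by
  have := Fintype.ofFinite G
  obtain ⟨y, rfl⟩ := residue_surjective y
  rw [← map_natCast (residue w.valuationSubring)] at hG
  obtain ⟨u, hu⟩ := (residue_ne_zero_iff_isUnit _).1 hG
  have hz (g : G) : g • ∑ h : G, h • y = ∑ h : G, h • y := by
    rw [Finset.smul_sum]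
    simp only [smul_smul]
    exact Equiv.sum_comp (Equiv.mulLeft g) fun h => h • y
  have hgu (g : G) : g • (u : w.valuationSubring) = u := by
    rw [hu]
    exact map_natCast (MulSemiringAction.toRingHom G w.valuationSubring g) _
  -- Average a lift over the group; `u` is the group order, a unit of the valuation ring.
  refine ⟨(↑u⁻¹ : w.valuationSubring) * ∑ h : G, h • y, fun g => ?_, ?_⟩
  · have h1 : (u : w.valuationSubring) * g • (↑u⁻¹ : w.valuationSubring) = 1 := by
      conv_lhs => rw [← hgu g]
      rw [← smul_mul', Units.mul_inv, smul_one]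
    rw [smul_mul', hz]; congr 1; exact (Units.inv_eq_of_mul_eq_one_right h1).symm
  · have h2 : residue _ (∑ h : G, h • y) = residue _ (u : w.valuationSubring) * residue _ y := by
      rw [map_sum, hu, map_natCast]
      simp [hy]
    rw [map_mul, h2, ← mul_assoc, ← map_mul, Units.inv_mul, map_one, one_mul]

end Valuation

end

/-! ### Conjugation in central division algebras -/

section

open Polynomial

section CentralDivision

variable {F A : Type*} [Field F] [DivisionRing A] [Algebra F A]

/-- The multiplication map `A ⊗ Aᵒᵖ → End A` of a central division algebra is injective. -/
lemma eq_zero_of_forall_sum_mul_mul_eq_zero [Algebra.IsCentral F A] {ι : Type*}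
    {n : ι → A} (hn : LinearIndependent F n) (s : Finset ι) (m : ι → A)
    (h : ∀ a, ∑ i ∈ s, m i * a * n i = 0) : ∀ i ∈ s, m i = 0 := by
  classical
  induction s using Finset.strongInduction generalizing m with
  | H s ih =>
    by_contra! hne
    obtain ⟨i₀, hi₀, hm⟩ := hne
    -- Shortest-relation argument: with one coefficient normalized to `1`, commutators with any `c`
    -- give a relation without that term. Hence all coefficients are central, and evaluating at `a =
    -- 1` gives an `F`-linear relation among the `n i`.
    set m' : ι → A := fun i => (m i₀)⁻¹ * m i
    have hm'1 : m' i₀ = 1 := inv_mul_cancel₀ hm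
    have h' (a : A) : ∑ i ∈ s, m' i * a * n i = 0 := by
      have : ∑ i ∈ s, m' i * a * n i = (m i₀)⁻¹ * ∑ i ∈ s, m i * a * n i := by
        simp [m', Finset.mul_sum, mul_assoc]
      rw [this, h, mul_zero]
    have hcomm (c : A) : ∀ i ∈ s, c * m' i = m' i * c := by
      intro i hi
      by_cases hii : i = i₀
      · rw [hii, hm'1, one_mul, mul_one]
      have := ih (s.erase i₀) (Finset.erase_ssubset hi₀) (fun i => c * m' i - m' i * c)
        (fun a => by
          rw [Finset.sum_erase _ (by simp [hm'1])]
          have h1 : ∑ i ∈ s, (c * m' i - m' i * c) * a * n i =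
              c * ∑ i ∈ s, m' i * a * n i - ∑ i ∈ s, m' i * (c * a) * n i := by
            rw [Finset.mul_sum, ← Finset.sum_sub_distrib]
            refine Finset.sum_congr rfl fun i _ => ?_
            noncomm_ring
          rw [h1, h', h', mul_zero, sub_zero]) i (Finset.mem_erase.2 ⟨hii, hi⟩)
      exact sub_eq_zero.1 this
    have hcen : ∀ i ∈ s, ∃ f : F, algebraMap F A f = m' i := fun i hi => by
      have : m' i ∈ Subalgebra.center F A :=
        Subalgebra.mem_center_iff.2 fun c => hcomm c i hi
      rw [Algebra.IsCentral.center_eq_bot, Algebra.mem_bot] at this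
      exact this
    choose! f hf using hcen
    have hzero := linearIndependent_iff'.1 hn s f (by
      rw [← h' 1]
      refine Finset.sum_congr rfl fun i hi => ?_
      rw [Algebra.smul_def, hf i hi, mul_one]) i₀ hi₀
    have h1 := hf i₀ hi₀
    rw [hzero, hm'1, map_zero] at h1
    exact zero_ne_one h1

variable {K : Type*} [Field K] [Algebra F K]

/-- Roots in a subfield of the minimal polynomial of an element are conjugate to the element. -/
lemma exists_mul_eq_mul_of_aeval_minpoly_eq_zero [Algebra.IsCentral F A] (j : K →ₐ[F] A) {x y : K}
    (hx : IsIntegral F x) (hy : aeval y (minpoly F x) = 0) :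
    ∃ a : A, a ≠ 0 ∧ a * j x = j y * a := by
  -- Coefficients act by left multiplication and `X` by right multiplication by `j x`; these
  -- commute, so `Φ` is a ring homomorphism, and it kills the minimal polynomial of `x`.
  let Φ : K[X] →+* Module.End F A := eval₂RingHom'
    ((Algebra.lmul F A).toRingHom.comp (j : K →+* A)) (LinearMap.mulRight F (j x)) fun c => by
      ext a
      simp [mul_assoc]
  have hC (c : K) (a : A) : Φ (C c) a = j c * a := by simp [Φ]
  have hX (a : A) : Φ X a = a * j x := by simp [Φ]
  have hXpow (n : ℕ) (a : A) : Φ (X ^ n) a = a * j x ^ n := by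
    induction n generalizing a with
    | zero => simp
    | succ n ih => rw [pow_succ, map_mul, Module.End.mul_apply, hX, ih, mul_assoc, ← pow_succ']
  have hΦ (q : K[X]) (a : A) :
      Φ q a = ∑ i ∈ Finset.range (q.natDegree + 1), j (q.coeff i) * a * j x ^ i := by
    conv_lhs => rw [q.as_sum_range_C_mul_X_pow]
    rw [map_sum, LinearMap.sum_apply]
    refine Finset.sum_congr rfl fun i _ => ?_
    rw [map_mul, Module.End.mul_apply, hXpow, hC, mul_assoc]
  have hmap (f : F[X]) (a : A) : Φ (f.map (algebraMap F K)) a = a * j (aeval x f) := by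
    induction f using Polynomial.induction_on' with
    | add p q hp hq => simp only [Polynomial.map_add, map_add, LinearMap.add_apply, hp, hq, mul_add]
    | monomial n c =>
      rw [← C_mul_X_pow_eq_monomial, Polynomial.map_mul, map_mul, Polynomial.map_pow, map_X, map_C,
        Module.End.mul_apply, hXpow, hC, map_mul, aeval_C, map_pow, aeval_X, map_mul, map_pow]
      simp only [AlgHom.commutes, ← mul_assoc, Algebra.commutes]
      rw [mul_assoc, Algebra.commutes, mul_assoc]
  have hroot : (minpoly F x).map (algebraMap F K) |>.IsRoot y := by
    rwa [IsRoot, eval_map_algebraMap]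
  obtain ⟨h, hh⟩ := dvd_iff_isRoot.2 hroot
  have hmon : ((minpoly F x).map (algebraMap F K)).Monic := (minpoly.monic hx).map _
  have hmonh : h.Monic := (monic_X_sub_C y).of_mul_monic_left (hh ▸ hmon)
  have hdeg : h.natDegree + 1 = (minpoly F x).natDegree := by
    rw [← natDegree_map (algebraMap F K), hh, (monic_X_sub_C y).natDegree_mul hmonh,
      natDegree_X_sub_C, add_comm]
  -- The cofactor `h` of `X - y` has degree below that of the minimal polynomial, so the powers of
  -- `j x` involved are independent and `Φ h` is not zero. Any nonzero value of `Φ h` is then the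
  -- required conjugator.
  have hne : ∃ a, Φ h a ≠ 0 := by
    by_contra! hall
    have hli : LinearIndependent F fun i : Fin (minpoly F x).natDegree => j x ^ (i : ℕ) := by
      simpa [Function.comp_def] using (linearIndependent_pow x (K := F)).map' j.toLinearMap
        (LinearMap.ker_eq_bot.2 (RingHom.injective (j : K →+* A)))
    have := eq_zero_of_forall_sum_mul_mul_eq_zero hli Finset.univ (fun i => j (h.coeff i))
      (fun a => by
        rw [Fin.sum_univ_eq_sum_range fun i => j (h.coeff i) * a * j x ^ i, ← hdeg, ← hΦ, hall])
      ⟨h.natDegree, by omega⟩ (Finset.mem_univ _)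
    simp [hmonh.coeff_natDegree] at this
  obtain ⟨a, ha⟩ := hne
  refine ⟨Φ h a, ha, ?_⟩
  have h0 : Φ ((X - C y) * h) a = 0 := by
    rw [← hh, hmap, minpoly.aeval, map_zero, mul_zero]
  rw [map_mul, Module.End.mul_apply, map_sub, LinearMap.sub_apply, hX, hC] at h0
  exact sub_eq_zero.1 h0

lemma exists_mul_eq_mul_of_algEquiv [Algebra.IsCentral F A] (j : K →ₐ[F] A) {x : K}
    (hx : IsIntegral F x) (σ : K ≃ₐ[F] K) : ∃ a : A, a ≠ 0 ∧ a * j x = j (σ x) * a :=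
  exists_mul_eq_mul_of_aeval_minpoly_eq_zero j hx <| by
    rw [← AlgEquiv.coe_toAlgHom, aeval_algHom_apply, minpoly.aeval, map_zero]

/-- A valuation of a central division algebra restricts to valuations of subfields that are
invariant under automorphisms. -/
lemma Valuation.isInvariant_comap_algHom [Algebra.IsCentral F A] [Algebra.IsIntegral F K]
    (j : K →ₐ[F] A) {Λ : Type*} [LinearOrderedCommGroupWithZero Λ] (w : Valuation A Λ) :
    (w.comap (j : K →+* A)).IsInvariant (K ≃ₐ[F] K) where
  map_smul σ x := by
    obtain ⟨a, ha, h⟩ := exists_mul_eq_mul_of_algEquiv j (Algebra.IsIntegral.isIntegral x) σ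
    -- The value group is commutative, so the value of the conjugator cancels.
    have h' := congrArg w h
    rw [map_mul, map_mul, mul_comm] at h'
    exact (mul_right_cancel₀ (w.ne_zero_iff.2 ha) h').symm

variable (F) in
/-- The Skolem-Noether theorem for subfields. -/
lemma exists_unit_conj [Algebra.IsCentral F A] [FiniteDimensional F K] [Algebra.IsSeparable F K]
    (j : K →ₐ[F] A) (σ : K ≃ₐ[F] K) : ∃ u : A, u ≠ 0 ∧ ∀ x, j x * u = u * j (σ x) := by
  obtain ⟨x, hx⟩ := Field.exists_primitive_element F K
  obtain ⟨u, hu, h⟩ := exists_mul_eq_mul_of_algEquiv j (Algebra.IsIntegral.isIntegral (σ x)) σ.symm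
  refine ⟨u, hu, ?_⟩
  rw [AlgEquiv.symm_apply_apply] at h
  have htop : Algebra.adjoin F {x} = ⊤ := by
    rw [← IntermediateField.adjoin_simple_toSubalgebra_of_isAlgebraic
      (Algebra.IsAlgebraic.isAlgebraic x), hx, IntermediateField.top_toSubalgebra]
  intro y
  have hy : y ∈ Algebra.adjoin F {x} := htop ▸ Algebra.mem_top
  induction hy using Algebra.adjoin_induction with
  | mem y hy => rw [Set.mem_singleton_iff.1 hy, h]
  | algebraMap r => simp only [AlgHom.commutes, AlgEquiv.commutes, Algebra.commutes]
  | add y z _ _ hy hz => simp only [map_add, add_mul, mul_add, hy, hz]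
  | mul y z _ _ hy hz => rw [map_mul, map_mul, map_mul, mul_assoc, hz, ← mul_assoc, hy, mul_assoc]

end CentralDivision

end

/-! ### Decomposition of an algebra over a Galois subfield -/

section GaloisSubfield

/-- Dual bases of a Galois extension, indexed by the Galois group. -/
lemma exists_dualBases (F K : Type*) [Field F] [Field K] [Algebra F K] [FiniteDimensional F K]
    [IsGalois F K] [DecidableEq (K ≃ₐ[F] K)] : ∃ e f : (K ≃ₐ[F] K) → K,
    (∀ x, ∑ i, Algebra.trace F K (x * f i) • e i = x) ∧
    (∀ x, ∑ i, Algebra.trace F K (x * e i) • f i = x) ∧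
    ∀ τ σ : K ≃ₐ[F] K, ∑ i, τ (e i) * σ (f i) = if τ = σ then 1 else 0 := by
  let b : Module.Basis (K ≃ₐ[F] K) F K := (Module.finBasis F K).reindex <|
    (finCongr (by rw [Fintype.card_eq_nat_card, IsGalois.card_aut_eq_finrank])).trans
      (Fintype.equivFin (K ≃ₐ[F] K)).symm
  refine ⟨b, b.traceDual, fun x => ?_, fun x => ?_, fun τ σ => ?_⟩
  · conv_rhs => rw [← b.sum_repr x]
    refine Finset.sum_congr rfl fun i _ => ?_
    conv_rhs => rw [← b.traceDual_traceDual]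
    rw [Module.Basis.traceDual_repr_apply, Algebra.traceForm_apply,
      Module.Basis.traceDual_traceDual]
  · conv_rhs => rw [← b.traceDual.sum_repr x]
    refine Finset.sum_congr rfl fun i _ => ?_
    rw [Module.Basis.traceDual_repr_apply, Algebra.traceForm_apply]
  · have h : (Matrix.of fun i σ => σ (b.traceDual i) : Matrix (K ≃ₐ[F] K) (K ≃ₐ[F] K) K) *
        (Matrix.of fun τ i => τ (b i)) = 1 := by
      ext i l
      simp only [Matrix.mul_apply, Matrix.of_apply, ← map_mul]
      rw [← trace_eq_sum_automorphisms, Module.Basis.trace_traceDual_mul, Matrix.one_apply]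
      simp only [eq_comm (a := i)]
      split_ifs <;> simp
    rw [mul_eq_one_comm] at h
    have := congrFun (congrFun h τ) σ
    simpa [Matrix.mul_apply, Matrix.one_apply] using this

variable {F K A : Type*} [Field F] [Field K] [Algebra F K] [DivisionRing A] [Algebra F A]
  [FiniteDimensional F K] [IsGalois F K] (j : K →ₐ[F] A)

omit [FiniteDimensional F K] [IsGalois F K] in
lemma mem_centralizerOf_iff {j : K →ₐ[F] A} {a : A} :
    a ∈ centralizerOf j ↔ ∀ x, j x * a = a * j x := by
  simp [Subalgebra.mem_centralizer_iff]

/-- The linear map `c ↦ ∑ u_σ c_σ` from families in the centralizer. -/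
noncomputable def sumUnitMul (u : (K ≃ₐ[F] K) → A) :
    ((K ≃ₐ[F] K) → centralizerOf j) →ₗ[F] A where
  toFun c := ∑ σ, u σ * c σ
  map_add' c c' := by simp [mul_add, Finset.sum_add_distrib]
  map_smul' r c := by simp [Finset.smul_sum]

variable {u : (K ≃ₐ[F] K) → A} (hu0 : ∀ σ, u σ ≠ 0) (hu : ∀ σ x, j x * u σ = u σ * j (σ x))
include hu0 hu

/-- The operator `a ↦ ∑ i, e i * a * σ (f i)` projects `A` onto its summand `u σ * C_A(K)`.
Dual-basis orthogonality isolates one coefficient, giving injectivity; summing the projections over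
`σ` turns `f i` into its trace and recovers `a`, giving surjectivity. -/
lemma sumUnitMul_bijective : Function.Bijective (sumUnitMul j u) := by
  classical
  obtain ⟨e, f, he, hf, hef⟩ := exists_dualBases F K
  have hc (c : centralizerOf j) (x : K) : (c : A) * j x = j x * c :=
    (mem_centralizerOf_iff.1 c.2 x).symm
  constructor
  · refine (injective_iff_map_eq_zero _).2 fun c hcz => funext fun σ => Subtype.ext ?_
    have hcz : ∑ τ, u τ * (c τ : A) = 0 := hcz
    have h1 : ∑ i, j (e i) * (∑ τ, u τ * (c τ : A)) * j (σ (f i)) = u σ * c σ := by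
      calc _ = ∑ i, ∑ τ, u τ * c τ * j (τ (e i) * σ (f i)) := by
            simp only [Finset.mul_sum, Finset.sum_mul]
            refine Finset.sum_congr rfl fun i _ => Finset.sum_congr rfl fun τ _ => ?_
            rw [map_mul, ← mul_assoc (j (e i)), hu, mul_assoc (u τ), ← hc]
            simp only [mul_assoc]
        _ = ∑ τ, u τ * c τ * j (∑ i, τ (e i) * σ (f i)) := by
            rw [Finset.sum_comm]
            simp only [map_sum, Finset.mul_sum]
        _ = u σ * c σ := by simp [hef]
    rw [hcz] at h1
    simpa [hu0] using h1.symm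
  · intro a
    let q (σ : K ≃ₐ[F] K) : A := ∑ i, j (e i) * a * j (σ (f i))
    have hq (σ : K ≃ₐ[F] K) (x : K) : j x * q σ = q σ * j (σ x) := by
      have h1 : j x * q σ =
          ∑ i, ∑ l, Algebra.trace F K (x * e i * f l) • (j (e l) * a * j (σ (f i))) := by
        simp only [q, Finset.mul_sum]
        refine Finset.sum_congr rfl fun i _ => ?_
        rw [← mul_assoc, ← mul_assoc, ← map_mul]
        conv_lhs => rw [← he (x * e i)]
        simp [Finset.sum_mul]
      have h2 : q σ * j (σ x) =
          ∑ l, ∑ i, Algebra.trace F K (x * e i * f l) • (j (e l) * a * j (σ (f i))) := by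
        simp only [q, Finset.sum_mul]
        refine Finset.sum_congr rfl fun l _ => ?_
        rw [mul_assoc, ← map_mul, ← map_mul]
        conv_lhs => rw [← hf (f l * x)]
        simp only [map_sum, Finset.mul_sum, map_smul, mul_smul_comm]
        refine Finset.sum_congr rfl fun i _ => ?_
        congr 2
        ring
      rw [h1, h2, Finset.sum_comm]
    have hmem (σ : K ≃ₐ[F] K) : (u σ)⁻¹ * q σ ∈ centralizerOf j := by
      rw [mem_centralizerOf_iff]
      intro x
      obtain ⟨y, rfl⟩ := σ.surjective x
      refine mul_left_cancel₀ (hu0 σ) ?_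
      rw [← mul_assoc, ← hu, mul_assoc, mul_inv_cancel_left₀ (hu0 σ), hq, mul_assoc (u σ)⁻¹,
        mul_inv_cancel_left₀ (hu0 σ)]
    refine ⟨fun σ => ⟨_, hmem σ⟩, ?_⟩
    calc ∑ σ, u σ * ((u σ)⁻¹ * q σ) = ∑ σ, q σ :=
          Finset.sum_congr rfl fun σ _ => mul_inv_cancel_left₀ (hu0 σ) _
      _ = ∑ i, j (e i) * a * algebraMap F A (Algebra.trace F K (f i)) := by
        simp only [q]
        rw [Finset.sum_comm]
        refine Finset.sum_congr rfl fun i _ => ?_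
        rw [← Finset.mul_sum, ← map_sum, ← trace_eq_sum_automorphisms, AlgHom.commutes]
      _ = j (∑ i, Algebra.trace F K (1 * f i) • e i) * a := by
        rw [map_sum, Finset.sum_mul]
        refine Finset.sum_congr rfl fun i _ => ?_
        rw [← Algebra.commutes, one_mul, map_smul, smul_mul_assoc, Algebra.smul_def]
      _ = a := by rw [he, map_one, one_mul]

omit hu0 hu

variable [Algebra.IsCentral F A]

/-- The dimension of the centralizer of a Galois subfield. -/
lemma finrank_eq_mul_finrank_centralizerOf :
    Module.finrank F A = Module.finrank F K * Module.finrank F (centralizerOf j) := by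
  classical
  choose u hu0 hu using exists_unit_conj F j
  rw [← (LinearEquiv.ofBijective _ (sumUnitMul_bijective j hu0 hu)).finrank_eq]
  by_cases hfin : FiniteDimensional F (centralizerOf j)
  · rw [Module.finrank_pi_fintype]
    simp [← Nat.card_eq_fintype_card, IsGalois.card_aut_eq_finrank]
  -- If the centralizer is infinite-dimensional, both sides are `0` by convention.
  · rw [Module.finrank_of_not_finite hfin, mul_zero]
    refine Module.finrank_of_not_finite fun h => hfin ?_
    exact Module.Finite.of_injective (LinearMap.single F (fun _ : K ≃ₐ[F] K => centralizerOf j) 1)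
      (LinearMap.ker_eq_bot.1 (LinearMap.ker_single ..))

end GaloisSubfield

/-! ### Inertia in Galois extensions of degree `p` and `p ^ 2` -/

section

open IsLocalRing

namespace Valuation

section Action

variable {G M Λ : Type*} [Field M] [LinearOrderedCommGroupWithZero Λ]
    [Group G] [MulSemiringAction G M] {w : Valuation M Λ} [w.IsInvariant G]

lemma smul_residue_eq_iff (g : G) (z : w.valuationSubring) :
    g • residue _ z = residue _ z ↔ w (g • (z : M) - z) < 1 := by
  rw [← ResidueField.residue_smul, ← sub_eq_zero, ← _root_.map_sub, residue_eq_zero_iff]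
  rfl

instance (H : Subgroup G) : w.IsInvariant H where
  map_smul g x := IsInvariant.map_smul (g : G) x

end Action

variable {F M Λ₀ Λ : Type*} [Field F] [Field M] [Algebra F M]
  [LinearOrderedCommGroupWithZero Λ₀] [LinearOrderedCommGroupWithZero Λ]

/-- If the value group does not grow, then the extension is not totally ramified. -/
lemma finrank_eq_one_of_isTotallyRamified (w : Valuation M Λ) (hw : w.IsTotallyRamified F)
    (h : ∀ x : M, ∃ f : F, w (algebraMap F M f) = w x) : Module.finrank F M = 1 := by
  rw [← hw, ramificationIndex, Subgroup.relIndex_eq_one, MonoidWithZeroHom.valueGroup_def,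
    Subgroup.closure_le]
  rintro u ⟨x, hx⟩
  obtain ⟨f, hf⟩ := h x
  exact MonoidWithZeroHom.mem_valueGroup _ ⟨f, hf.trans hx⟩

variable [FiniteDimensional F M] [IsGalois F M] {w : Valuation M Λ} [w.IsInvariant (M ≃ₐ[F] M)]

variable (F) in
lemma exists_val_algebraMap_eq [FaithfulSMul (M ≃ₐ[F] M) w.Residue] (x : M) :
    ∃ f : F, w (algebraMap F M f) = w x := by
  obtain ⟨z, hz, hzx⟩ := exists_fixed_val_eq (w := w) (M ≃ₐ[F] M) x
  obtain ⟨f, rfl⟩ := (IsGalois.mem_range_algebraMap_iff_fixed z).2 hz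
  exact ⟨f, hzx⟩

/-- The Galois group of a totally ramified extension of prime degree acts trivially on the
residue field. -/
lemma smul_residue_of_isTotallyRamified (hp : (Module.finrank F M).Prime)
    (hw : w.IsTotallyRamified F) (g : M ≃ₐ[F] M) (y : w.Residue) : g • y = y := by
  let φ := MulSemiringAction.toRingAut (M ≃ₐ[F] M) w.Residue
  have : Fact (Nat.card (M ≃ₐ[F] M)).Prime := ⟨by rwa [IsGalois.card_aut_eq_finrank]⟩
  rcases φ.ker.eq_bot_or_eq_top_of_prime_card with h | h
  · have : FaithfulSMul (M ≃ₐ[F] M) w.Residue := ⟨fun {g₁ g₂} h12 =>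
      (MonoidHom.ker_eq_bot_iff _).1 h (RingEquiv.ext h12)⟩
    exact absurd (finrank_eq_one_of_isTotallyRamified w hw (exists_val_algebraMap_eq F)) hp.ne_one
  · have hg : g ∈ φ.ker := h ▸ Subgroup.mem_top g
    exact RingEquiv.congr_fun (MonoidHom.mem_ker.1 hg) y

/-- Residues fixed by the Galois group of a Galois extension of degree prime to the residue
characteristic are residues of the base field. -/
lemma exists_algebraMap_residue_eq (v : Valuation F Λ₀) [v.HasExtension w]
    (hn : (Module.finrank F M : w.Residue) ≠ 0) {y : w.Residue}
    (hy : ∀ g : M ≃ₐ[F] M, g • y = y) : ∃ x : v.Residue, algebraMap v.Residue w.Residue x = y := by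
  rw [← IsGalois.card_aut_eq_finrank] at hn
  obtain ⟨z, hz, rfl⟩ := exists_fixed_residue_eq (M ≃ₐ[F] M) hn y hy
  obtain ⟨f, hf⟩ := (IsGalois.mem_range_algebraMap_iff_fixed (F := F) (z : M)).2 fun g =>
    congrArg Subtype.val (hz g)
  have hfv : v f ≤ 1 := by
    rw [← HasExtension.val_map_le_one_iff v w, hf]
    exact z.2
  refine ⟨residue _ ⟨f, hfv⟩, ?_⟩
  rw [HasExtension.algebraMap_residue_eq_residue_algebraMap]
  congr 1
  exact Subtype.ext hf

end Valuation

/-- A subgroup of a finite cyclic group contains all subgroups whose order divides its order. -/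
lemma IsCyclic.subgroup_le_of_card_dvd {G : Type*} [Group G] [Finite G] [IsCyclic G]
    {H N : Subgroup G} (h : Nat.card H ∣ Nat.card N) : H ≤ N := by
  classical
  have := Fintype.ofFinite G
  -- In a cyclic group `x ^ n = 1` has at most `n` solutions, so `N` contains all those for its
  -- order.
  have hN : (Finset.univ.filter fun x : G => x ∈ N) =
      Finset.univ.filter fun x : G => x ^ Nat.card N = 1 := by
    refine Finset.eq_of_subset_of_card_le (fun x hx => ?_) ?_
    · simp only [Finset.mem_filter, Finset.mem_univ, true_and] at hx ⊢
      exact congrArg Subtype.val (pow_card_eq_one' (x := (⟨x, hx⟩ : N)))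
    · refine (IsCyclic.card_pow_eq_one_le Nat.card_pos).trans_eq ?_
      rw [Nat.card_eq_fintype_card, Fintype.card_subtype]
  intro x hx
  have h1 : x ^ Nat.card H = 1 := congrArg Subtype.val (pow_card_eq_one' (x := (⟨x, hx⟩ : H)))
  have h2 : x ∈ Finset.univ.filter fun x : G => x ^ Nat.card N = 1 := by
    obtain ⟨c, hc⟩ := h
    rw [Finset.mem_filter, hc, pow_mul, h1, one_pow]
    exact ⟨Finset.mem_univ _, rfl⟩
  rw [← hN] at h2
  simpa using h2

namespace Valuation

variable {F M Λ₀ Λ : Type*} [Field F] [Field M] [Algebra F M]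
  [LinearOrderedCommGroupWithZero Λ₀] [LinearOrderedCommGroupWithZero Λ]
  [FiniteDimensional F M] [IsGalois F M] {w : Valuation M Λ} [w.IsInvariant (M ≃ₐ[F] M)]

/-- The Galois group of a cyclic extension of degree `p ^ 2` that is tamely ramified with ramified
subextension of degree `p` acts trivially on the residue field. -/
lemma smul_residue_of_isCyclic {p : ℕ} (hp : p.Prime) (hM : Module.finrank F M = p ^ 2)
    [IsCyclic (M ≃ₐ[F] M)] (hpw : (p : w.Residue) ≠ 0)
    {K : Type*} [Field K] [Algebra F K] [Algebra K M] [IsScalarTower F K M] [IsGalois F K]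
    (hK : Module.finrank F K = p) (hw : (w.comap (algebraMap K M)).IsTotallyRamified F)
    (g : M ≃ₐ[F] M) (y : w.Residue) : g • y = y := by
  have : FiniteDimensional F K := .of_finrank_pos (hK ▸ hp.pos)
  let φ := MulSemiringAction.toRingAut (M ≃ₐ[F] M) w.Residue
  have hinv : (w.comap (algebraMap K M)).IsInvariant (K ≃ₐ[F] K) := ⟨fun g x => by
    have := IsInvariant.map_smul (w := w) (g.liftNormal M) (algebraMap K M x)
    rwa [AlgEquiv.smul_def, AlgEquiv.liftNormal_commutes] at this⟩
  -- With trivial inertia every value of `M` would come from `F`, against the ramification of `K`.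
  have hN : φ.ker ≠ ⊥ := by
    intro h
    have : FaithfulSMul (M ≃ₐ[F] M) w.Residue := ⟨fun {g₁ g₂} h12 =>
      (MonoidHom.ker_eq_bot_iff _).1 h (RingEquiv.ext h12)⟩
    refine hp.ne_one (hK ▸ finrank_eq_one_of_isTotallyRamified _ hw fun x => ?_)
    obtain ⟨f, hf⟩ := exists_val_algebraMap_eq F (w := w) (algebraMap K M x)
    refine ⟨f, ?_⟩
    rw [comap_apply, comap_apply, ← IsScalarTower.algebraMap_apply, hf]
  let E : IntermediateField F M := (IsScalarTower.toAlgHom F K M).fieldRange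
  let H := E.fixingSubgroup
  have hH : Nat.card H = p := by
    have h1 : Module.finrank F E = p :=
      hK ▸ (AlgEquiv.ofInjectiveField (IsScalarTower.toAlgHom F K M)).toLinearEquiv.finrank_eq.symm
    have h2 := Module.finrank_mul_finrank F E M
    rw [h1, hM, sq] at h2
    rw [IsGalois.card_fixingSubgroup_eq_finrank, mul_left_cancel₀ hp.ne_zero h2]
  -- A nontrivial subgroup of a cyclic `p`-group contains the subgroup of order `p`, here the group
  -- of `M` over `K`.
  have hHN : H ≤ φ.ker := by
    apply IsCyclic.subgroup_le_of_card_dvd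
    rw [hH]
    have h1 := φ.ker.card_subgroup_dvd_card
    rw [IsGalois.card_aut_eq_finrank, hM, Nat.dvd_prime_pow hp] at h1
    obtain ⟨k, -, hk⟩ := h1
    rcases k with - | k
    · exact absurd (φ.ker.eq_bot_of_card_eq hk) hN
    · rw [hk, pow_succ]
      exact dvd_mul_left _ _
  -- Hence every residue of `M` lifts to `K`, where the totally ramified case of prime degree
  -- applies.
  obtain ⟨z, hz, rfl⟩ := exists_fixed_residue_eq H (w := w) (by rwa [hH]) y fun h =>
    RingEquiv.congr_fun (MonoidHom.mem_ker.1 (hHN h.2)) y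
  have hzE : (z : M) ∈ E := by
    rw [← IsGalois.fixedField_fixingSubgroup E]
    exact fun h => congrArg Subtype.val (hz h)
  obtain ⟨x, hx⟩ := hzE
  have hx : algebraMap K M x = z := hx
  have hxw : w.comap (algebraMap K M) x ≤ 1 := by
    rw [comap_apply, hx]
    exact z.2
  have h1 := smul_residue_of_isTotallyRamified (hK ▸ hp) hw (g.restrictNormal K)
    (residue (w.comap (algebraMap K M)).valuationSubring ⟨x, hxw⟩)
  rw [smul_residue_eq_iff, comap_apply, _root_.map_sub, AlgEquiv.smul_def,
    AlgEquiv.restrictNormal_commutes, hx] at h1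
  rwa [smul_residue_eq_iff]

/-- The whole group is inertia, so if every character value of a generator `σ` had `p`-th power `1`,
then `σ ^ p` would be trivial. Some value thus has order exactly `p ^ 2`; it is fixed by the group
and so comes from the residue field of `F`. -/
lemma exists_isPrimitiveRoot_of_isCyclic {p : ℕ} (hp : p.Prime) (hM : Module.finrank F M = p ^ 2)
    [IsCyclic (M ≃ₐ[F] M)] (hpw : (p : w.Residue) ≠ 0)
    {K : Type*} [Field K] [Algebra F K] [Algebra K M] [IsScalarTower F K M] [IsGalois F K]
    (hK : Module.finrank F K = p) (hw : (w.comap (algebraMap K M)).IsTotallyRamified F)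
    (v : Valuation F Λ₀) [v.HasExtension w] : ∃ ζ : v.Residue, IsPrimitiveRoot ζ (p ^ 2) := by
  have htriv := smul_residue_of_isCyclic hp hM hpw hK hw
  obtain ⟨σ, hσ⟩ := IsCyclic.exists_ofOrder_eq_natCard (α := M ≃ₐ[F] M)
  rw [IsGalois.card_aut_eq_finrank, hM] at hσ
  have : ∃ x : M, x ≠ 0 ∧ w.tameChar σ x ^ p ≠ 1 := by
    by_contra! h
    have h1 : σ ^ p = 1 := by
      ext y
      refine smul_eq_of_tameChar_eq_one (w := w) (g := σ ^ p) (n := p) ?_ hpw (fun x hx => ?_) y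
      · rw [← pow_mul, ← sq, ← hσ, pow_orderOf_eq_one]
      · rw [tameChar_pow_left (htriv σ) hx, h x hx]
    have h2 := Nat.le_of_dvd hp.pos (orderOf_dvd_of_pow_eq_one h1)
    rw [hσ] at h2
    nlinarith [hp.two_le]
  obtain ⟨x, hx0, hx⟩ := this
  have hn : (Module.finrank F M : w.Residue) ≠ 0 := by
    rw [hM, Nat.cast_pow]
    exact pow_ne_zero _ hpw
  obtain ⟨ζ, hζ⟩ := exists_algebraMap_residue_eq v hn (y := w.tameChar σ x) fun g => htriv g _
  refine ⟨ζ, IsPrimitiveRoot.of_map_of_injective (f := algebraMap v.Residue w.Residue) ?_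
    (algebraMap v.Residue w.Residue).injective⟩
  have : Fact p.Prime := ⟨hp⟩
  rw [hζ, IsPrimitiveRoot.iff_orderOf]
  refine orderOf_eq_prime_pow (by simpa using hx) ?_
  rw [← tameChar_pow_left (htriv σ) hx0, ← hσ, pow_orderOf_eq_one, tameChar_one_left w hx0]

/-- A noncyclic Galois extension of degree `p ^ 2` forces a finite residue field prime to `p` to
contain the `p`-th roots of unity. -/
lemma card_residue_modEq_one {p : ℕ} (hp : p.Prime) (hM : Module.finrank F M = p ^ 2)
    (hcyc : ¬ IsCyclic (M ≃ₐ[F] M)) (hpw : (p : w.Residue) ≠ 0)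
    (v : Valuation F Λ₀) [v.HasExtension w] [Finite v.Residue] :
    Nat.card v.Residue ≡ 1 [MOD p] := by
  have : Fact p.Prime := ⟨hp⟩
  have hcard : Nat.card (M ≃ₐ[F] M) = p ^ 2 := by rw [IsGalois.card_aut_eq_finrank, hM]
  have hn : (Module.finrank F M : w.Residue) ≠ 0 := by
    rw [hM, Nat.cast_pow]
    exact pow_ne_zero _ hpw
  let k₀ := FixedPoints.subfield (M ≃ₐ[F] M) w.Residue
  have : Finite k₀ := by
    have hr (y : k₀) : ∃ x : v.Residue, algebraMap v.Residue w.Residue x = y :=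
      exists_algebraMap_residue_eq v hn y.2
    choose f hf using hr
    exact Finite.of_injective f fun y z h => Subtype.ext (by rw [← hf, ← hf, h])
  have : Finite w.Residue := Module.finite_of_finite k₀
  let φ := MulSemiringAction.toAlgAut (M ≃ₐ[F] M) k₀ w.Residue
  -- Automorphism groups of extensions of finite fields are cyclic.
  have hφ : ¬ Function.Injective φ := fun h => hcyc (isCyclic_of_injective φ h)
  rw [← MonoidHom.ker_eq_bot_iff, ← Ne, Subgroup.ne_bot_iff_exists_ne_one] at hφ
  obtain ⟨⟨τ, hτ⟩, hτ1⟩ := hφ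
  have hτ1 : τ ≠ 1 := fun h => hτ1 (Subtype.ext h)
  have htriv (y : w.Residue) : τ • y = y := AlgEquiv.congr_fun (MonoidHom.mem_ker.1 hτ) y
  have hτp : τ ^ p = 1 := by
    have h := orderOf_dvd_natCard τ
    rw [hcard, Nat.dvd_prime_pow hp] at h
    obtain ⟨i, hi, h⟩ := h
    interval_cases i
    · exact absurd (orderOf_eq_one_iff.1 h) hτ1
    · rw [← pow_one p, ← h, pow_orderOf_eq_one]
    · exact absurd (isCyclic_of_orderOf_eq_card τ (h.trans hcard.symm)) hcyc
  have : ∃ x : M, x ≠ 0 ∧ w.tameChar τ x ≠ 1 := by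
    by_contra! h
    exact hτ1 (AlgEquiv.ext fun y => smul_eq_of_tameChar_eq_one hτp hpw h y)
  obtain ⟨x, hx0, hx⟩ := this
  -- A group of order `p ^ 2` is abelian, so the character value of `τ` is fixed by the whole group,
  -- even where that group acts nontrivially on residues.
  have hcomm := (IsPGroup.isMulCommutative_of_card_eq_prime_sq hcard).is_comm.comm
  obtain ⟨ζ, hζ⟩ := exists_algebraMap_residue_eq v hn (y := w.tameChar τ x) fun g =>
    smul_tameChar htriv (hcomm g τ) hx0
  have hζp : ζ ^ p = 1 := by
    apply (algebraMap v.Residue w.Residue).injective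
    rw [map_pow, hζ, ← tameChar_pow_left htriv hx0, hτp, tameChar_one_left w hx0, map_one]
  have hζ1 : ζ ≠ 1 := by
    rintro rfl
    exact hx (by rw [← hζ, map_one])
  have hζ0 : ζ ≠ 0 := by
    rintro rfl
    simp [hp.ne_zero] at hζp
  have hord : orderOf (Units.mk0 ζ hζ0) = p := orderOf_eq_prime (Units.ext hζp)
    fun h => hζ1 (congrArg Units.val h)
  have := orderOf_dvd_natCard (Units.mk0 ζ hζ0)
  rw [hord, Nat.card_units] at this
  exact ((Nat.modEq_iff_dvd' Nat.card_pos).2 this).symm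

end Valuation

end

/-! ### Maximal subfields and the case distinction for the first assertion -/

section MaximalSubfields

variable {F A : Type*} [Field F] [DivisionRing A] [Algebra F A]

/-- A commutative subalgebra of a finite-dimensional division algebra is a field. -/
lemma Subalgebra.isField_of_comm [FiniteDimensional F A] (N : Subalgebra F A)
    (h : ∀ x ∈ N, ∀ y ∈ N, x * y = y * x) : IsField N where
  exists_pair_ne := ⟨0, 1, zero_ne_one⟩
  mul_comm x y := Subtype.ext (h x x.2 y y.2)
  mul_inv_cancel {a} ha := by
    have h0 : (a : A) ≠ 0 := fun h => ha (Subtype.ext h)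
    have hinj : Function.Injective (LinearMap.mulLeft F a) := fun x y hxy =>
      Subtype.ext (mul_left_cancel₀ h0 (congrArg Subtype.val hxy))
    obtain ⟨b, hb⟩ := LinearMap.surjective_of_injective hinj 1
    exact ⟨b, hb⟩

/-- A maximal commutative subalgebra contains its centralizer. -/
lemma Subalgebra.centralizer_le_of_isMaximalCommutative {A : Type*} [Ring A] [Algebra F A]
    {M : Subalgebra F A} (hM : M.IsMaximalCommutative) :
    Subalgebra.centralizer F (M : Set A) ≤ M := by
  intro a ha
  have hcomm : ∀ x ∈ insert a (M : Set A), ∀ y ∈ insert a (M : Set A), x * y = y * x := by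
    have ha' : ∀ y ∈ M, y * a = a * y := fun y hy => Subalgebra.mem_centralizer_iff F |>.1 ha y hy
    rintro x (rfl | hx) y (rfl | hy)
    · rfl
    · exact (ha' y hy).symm
    · exact ha' x hx
    · exact hM.1 x hx y hy
  have := Algebra.isMulCommutative_adjoin F hcomm
  have hle : M ≤ Algebra.adjoin F (insert a (M : Set A)) := fun x hx =>
    Algebra.subset_adjoin (Set.mem_insert_of_mem a hx)
  refine hM.2 (fun x hx y hy => ?_) hle (Algebra.subset_adjoin (Set.mem_insert a _))
  exact congrArg Subtype.val (this.is_comm.comm ⟨x, hx⟩ ⟨y, hy⟩)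

/-- In a finite-dimensional division algebra the commutative subalgebras are exactly the subfields.
-/
lemma Subalgebra.IsMaximalSubfield.isMaximalCommutative [FiniteDimensional F A]
    {M : Subalgebra F A} (hM : M.IsMaximalSubfield) : M.IsMaximalCommutative :=
  ⟨fun x hx y hy => congrArg Subtype.val (hM.1.mul_comm ⟨x, hx⟩ ⟨y, hy⟩),
    fun N hN hle => hM.2 (N.isField_of_comm hN) hle⟩

variable [Algebra.IsCentral F A] {M : Type*} [Field M] [Algebra F M] [FiniteDimensional F M]
  [IsGalois F M]

/-- A self-centralizing subfield makes both factors of the centralizer dimension formula equal. -/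
lemma finrank_eq_sq_of_centralizerOf_le (j : M →ₐ[F] A) (hj : centralizerOf j ≤ j.range) :
    Module.finrank F A = Module.finrank F M ^ 2 := by
  have h : centralizerOf j = j.range := by
    refine le_antisymm hj ?_
    rintro _ ⟨x, rfl⟩
    rw [mem_centralizerOf_iff]
    intro y
    exact (map_mul j y x).symm.trans ((congrArg j (mul_comm y x)).trans (map_mul j x y))
  rw [finrank_eq_mul_finrank_centralizerOf j, h, sq,
    ← (AlgEquiv.ofInjectiveField j).toLinearEquiv.finrank_eq]

/-- Under the hypotheses on the valuations there is no Galois extension of degree `p ^ 2` of `F`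
in `A` containing `K`. -/
lemma not_exists_galois_of_valuations {K : Type*} [Field K] [Algebra F K]
    {p : ℕ} (hp : p.Prime) [IsGalois F K] (hK : Module.finrank F K = p) (ι : K →ₐ[F] A)
    {Λ₁ Λ₂ Λ₁' Λ₂' : Type*}
    [LinearOrderedCommGroupWithZero Λ₁] [LinearOrderedCommGroupWithZero Λ₂]
    [LinearOrderedCommGroupWithZero Λ₁'] [LinearOrderedCommGroupWithZero Λ₂']
    (v₁ : Valuation F Λ₁) (v₂ : Valuation F Λ₂)
    (w₁ : Valuation A Λ₁') [v₁.HasExtension w₁] (w₂ : Valuation A Λ₂') [v₂.HasExtension w₂]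
    (h₁ : (w₁.comap (ι : K →+* A)).IsTotallyRamified F)
    (h₁p : (p : v₁.Residue) ≠ 0) (h₁μ : ¬ ∃ ζ : v₁.Residue, IsPrimitiveRoot ζ (p ^ 2))
    [Finite v₂.Residue] (h₂p : (p : v₂.Residue) ≠ 0)
    (h₂1 : ¬ Nat.card v₂.Residue ≡ 1 [MOD p])
    (j : M →ₐ[F] A) (hj : ι.range ≤ j.range) : Module.finrank F M ≠ p ^ 2 := by
  intro hM
  -- The embedding of `K` in `M` compatible with the embeddings `ι` and `j` in `A`.
  let κ : K →ₐ[F] M := (AlgEquiv.ofInjectiveField j).symm.toAlgHom.comp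
    ((Subalgebra.inclusion hj).comp ι.rangeRestrict)
  have hκ (x : K) : j (κ x) = ι x := by
    have := (AlgEquiv.ofInjectiveField j).apply_symm_apply ⟨ι x, hj ⟨x, rfl⟩⟩
    exact congrArg Subtype.val this
  let : Algebra K M := κ.toAlgebra
  have : IsScalarTower F K M := .of_algHom κ
  have hinv₁ := Valuation.isInvariant_comap_algHom j w₁
  have hinv₂ := Valuation.isInvariant_comap_algHom j w₂
  by_cases hcyc : IsCyclic (M ≃ₐ[F] M)
  · refine h₁μ (Valuation.exists_isPrimitiveRoot_of_isCyclic (w := w₁.comap (j : M →+* A)) hp hM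
      ?_ (K := K) hK ?_ v₁)
    · rw [← map_natCast (algebraMap v₁.Residue _)]
      exact (map_ne_zero _).2 h₁p
    · convert h₁ using 1
      ext x
      exact congrArg w₁ (hκ x)
  · refine h₂1 (Valuation.card_residue_modEq_one (w := w₂.comap (j : M →+* A)) hp hM hcyc ?_ v₂)
    rw [← map_natCast (algebraMap v₂.Residue _)]
    exact (map_ne_zero _).2 h₂p

end MaximalSubfields

/-! ### Dimension, centre and invertibility in the Mal'cev–Neumann ring -/

namespace MalcevNeumannRing

open MalcevNeumannDatum

section Basic

variable {F K A : Type*} [Field F] [Field K] [Algebra F K] [Ring A] [Algebra F A]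
  {ι : K →ₐ[F] A} {Γ : Type*} [AddCommGroup Γ] [LinearOrder Γ] {d : MalcevNeumannDatum ι Γ}

/-- The monomial `a_γ r`. -/
noncomputable def monomial (d : MalcevNeumannDatum ι Γ) (γ : Γ) (r : centralizerOf ι) :
    MalcevNeumannRing d := HahnSeries.single γ r

lemma toHahn_monomial (γ : Γ) (r : centralizerOf ι) :
    (monomial d γ r).toHahn = HahnSeries.single γ (d.unit γ * (r : A)) := by
  ext δ
  have h : (monomial d γ r).coeff δ = (HahnSeries.single γ r).coeff δ := rfl
  rw [toHahn_coeff, h, HahnSeries.coeff_single, HahnSeries.coeff_single]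
  split_ifs with h
  · rw [h]
  · simp

lemma toHahn_coeff_zero (f : MalcevNeumannRing d) : f.toHahn.coeff 0 = f.coeff 0 := by
  rw [toHahn_coeff, d.unit_of_aut_eq_one d.aut_zero, Units.val_one, one_mul]

omit [LinearOrder Γ] in
lemma mem_ker_iff {γ : Γ} : γ ∈ d.ε.ker ↔ d.aut γ = 1 := Iff.rfl

variable [IsOrderedAddMonoid Γ]

variable (d) in
/-- The embedding of the Mal'cev-Neumann ring in the ring of Hahn series. -/
noncomputable def toHahnHom : MalcevNeumannRing d →+* HahnSeries Γ A where
  toFun := toHahn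
  map_one' := toHahn_one
  map_mul' := toHahn_mul
  map_zero' := toHahn_zero
  map_add' := toHahn_add

lemma toHahn_algebraMap_coeff (z : HahnSeries d.ε.ker F) (γ : d.ε.ker) :
    (algebraMap _ (MalcevNeumannRing d) z).toHahn.coeff γ = algebraMap F A (z.coeff γ) := by
  change (ofKer z).toHahn.coeff γ = _
  rw [toHahn_coeff, coeff_ofKer, d.unit_of_aut_eq_one (mem_ker_iff.1 γ.2), Units.val_one, one_mul]
  rfl

lemma toHahn_algebraMap_coeff_of_notMem (z : HahnSeries d.ε.ker F) {γ : Γ} (h : γ ∉ d.ε.ker) :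
    (algebraMap _ (MalcevNeumannRing d) z).toHahn.coeff γ = 0 := by
  change (ofKer z).toHahn.coeff γ = _
  rw [toHahn_coeff, coeff_ofKer_of_notMem z h, ZeroMemClass.coe_zero, mul_zero]

omit [IsOrderedAddMonoid Γ] [LinearOrder Γ] in
lemma unit_eq_of_sub_mem_ker {γ δ : Γ} (h : γ - δ ∈ d.ε.ker) : d.unit γ = d.unit δ := by
  rw [unit, unit, ← sub_add_cancel γ δ, aut_add, mem_ker_iff.1 h, one_mul]

lemma coeff_smul_monomial (z : HahnSeries d.ε.ker F) {γ δ : Γ} (r : centralizerOf ι)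
    (h : γ - δ ∈ d.ε.ker) : (z • monomial d δ r).coeff γ = z.coeff ⟨γ - δ, h⟩ • r := by
  refine Subtype.ext ((Units.mul_right_inj (d.unit γ)).1 ?_)
  have h1 := HahnSeries.coeff_mul_single_add (r := d.unit δ * (r : A))
    (x := (algebraMap _ (MalcevNeumannRing d) z).toHahn) (a := γ - δ) (b := δ)
  rw [sub_add_cancel, toHahn_algebraMap_coeff z ⟨γ - δ, h⟩] at h1
  rw [← toHahn_coeff, Algebra.smul_def, toHahn_mul, toHahn_monomial, h1,
    unit_eq_of_sub_mem_ker h, Algebra.commutes, mul_assoc, Subalgebra.coe_smul, Algebra.smul_def,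
    ← Algebra.commutes]

lemma coeff_smul_monomial_of_notMem (z : HahnSeries d.ε.ker F) {γ δ : Γ} (r : centralizerOf ι)
    (h : γ - δ ∉ d.ε.ker) : (z • monomial d δ r).coeff γ = 0 := by
  refine Subtype.ext ((Units.mul_right_inj (d.unit γ)).1 ?_)
  rw [← toHahn_coeff, Algebra.smul_def, toHahn_mul, toHahn_monomial, ← sub_add_cancel γ δ,
    HahnSeries.coeff_mul_single_add, toHahn_algebraMap_coeff_of_notMem z h, zero_mul,
    ZeroMemClass.coe_zero, mul_zero]

lemma coeff_sum {α : Type*} (s : Finset α) (f : α → MalcevNeumannRing d) (γ : Γ) :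
    (∑ i ∈ s, f i).coeff γ = ∑ i ∈ s, (f i).coeff γ :=
  map_sum (⟨⟨fun f => f.coeff γ, coeff_zero γ⟩, fun f g => coeff_add f g γ⟩ :
    MalcevNeumannRing d →+ centralizerOf ι) f s

variable {J : Type*} [Fintype J]

/-- The linear combinations of the monomials `a_{g σ} b_j`. -/
noncomputable def sumMonomial [Fintype (K ≃ₐ[F] K)] (d : MalcevNeumannDatum ι Γ)
    (g : (K ≃ₐ[F] K) → Γ) (b : J → centralizerOf ι) :
    ((K ≃ₐ[F] K) × J → HahnSeries d.ε.ker F) →ₗ[HahnSeries d.ε.ker F] MalcevNeumannRing d :=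
  Fintype.linearCombination _ fun i => monomial d (g i.1) (b i.2)

/-- The cosets of `ker ε` are the fibres of `d.aut`, so only the monomials with `σ = d.aut γ`
contribute at `γ`. -/
lemma coeff_sumMonomial [Fintype (K ≃ₐ[F] K)] {g : (K ≃ₐ[F] K) → Γ} (hg : ∀ σ, d.aut (g σ) = σ)
    (b : J → centralizerOf ι) (c : (K ≃ₐ[F] K) × J → HahnSeries d.ε.ker F) (γ : Γ)
    (h : γ - g (d.aut γ) ∈ d.ε.ker) :
    (sumMonomial d g b c).coeff γ = ∑ i, (c (d.aut γ, i)).coeff ⟨γ - g (d.aut γ), h⟩ • b i := by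
  classical
  rw [sumMonomial, Fintype.linearCombination_apply, coeff_sum, Fintype.sum_prod_type,
    Finset.sum_eq_single (d.aut γ)]
  · exact Finset.sum_congr rfl fun i _ => coeff_smul_monomial _ _ h
  · intro σ _ hσ
    refine Finset.sum_eq_zero fun i _ => coeff_smul_monomial_of_notMem _ _ fun hm => hσ ?_
    have := d.aut_add (γ - g σ) (g σ)
    rw [sub_add_cancel, mem_ker_iff.1 hm, one_mul, hg] at this
    exact this.symm
  · simp

omit [IsOrderedAddMonoid Γ] [LinearOrder Γ] in
lemma sub_mem_ker {g : (K ≃ₐ[F] K) → Γ} (hg : ∀ σ, d.aut (g σ) = σ) (γ : Γ) :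
    γ - g (d.aut γ) ∈ d.ε.ker := by
  rw [mem_ker_iff]
  have := d.aut_add (γ - g (d.aut γ)) (g (d.aut γ))
  rwa [sub_add_cancel, hg, right_eq_mul] at this

lemma sumMonomial_bijective [Fintype (K ≃ₐ[F] K)] {g : (K ≃ₐ[F] K) → Γ}
    (hg : ∀ σ, d.aut (g σ) = σ) (b : Module.Basis J F (centralizerOf ι)) :
    Function.Bijective (sumMonomial d g b) := by
  constructor
  · refine (injective_iff_map_eq_zero _).2 fun c hc => ?_
    ext ⟨σ, i⟩ κ
    have hσ : d.aut (κ + g σ) = σ := by rw [aut_add, hg, mem_ker_iff.1 κ.2, one_mul]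
    have h := coeff_sumMonomial hg b c (κ + g σ) (sub_mem_ker hg _)
    rw [hc, coeff_zero] at h
    have h2 := Fintype.linearIndependent_iff.1 b.linearIndependent _ h.symm i
    simpa [hσ] using h2
  · intro f
    -- Coordinates: restrict the series to the coset of `g σ`, translate it to `ker ε`, and expand
    -- its coefficients in the basis `b`.
    refine ⟨fun p => ⟨fun κ => b.repr (f.coeff (κ + g p.1)) p.2, ?_⟩, ?_⟩
    · refine Set.IsPWO.mono (t := {κ : d.ε.ker | (κ : Γ) + g p.1 ∈ f.supp}) ?_ fun κ hκ => ?_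
      · rw [Set.isPWO_iff_exists_monotone_subseq]
        intro u hu
        obtain ⟨φ, hφ⟩ := f.isPWO_supp.exists_monotone_subseq hu
        exact ⟨φ, fun m n hmn => Subtype.coe_le_coe.1 (le_of_add_le_add_right (hφ hmn))⟩
      · contrapose! hκ
        have h0 : f.coeff (κ + g p.1) = 0 := by simpa [supp] using hκ
        simp [h0]
    · refine ext_coeff fun γ => ?_
      rw [coeff_sumMonomial hg b _ γ (sub_mem_ker hg γ)]
      simp only [sub_add_cancel]
      exact b.sum_repr _

end Basic

section Division

variable {F K A : Type*} [Field F] [Field K] [Algebra F K] [DivisionRing A] [Algebra F A]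
  {ι : K →ₐ[F] A} {Γ : Type*} [AddCommGroup Γ] [LinearOrder Γ] [IsOrderedAddMonoid Γ]
  (d : MalcevNeumannDatum ι Γ)

instance : IsDomain (MalcevNeumannRing d) :=
  (toHahn_injective (d := d)).isDomain (toHahnHom d)

variable [FiniteDimensional F K] [IsGalois F K] [FiniteDimensional F A] [Algebra.IsCentral F A]

/-- The monomial basis has `[K : F]` times `dim C_A(K)` elements, which is `dim A` by the
centralizer formula. -/
lemma finite_and_finrank_eq : Module.Finite (HahnSeries d.ε.ker F) (MalcevNeumannRing d) ∧
    Module.finrank (HahnSeries d.ε.ker F) (MalcevNeumannRing d) = Module.finrank F A := by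
  obtain ⟨g, hg⟩ : ∃ g : (K ≃ₐ[F] K) → Γ, ∀ σ, d.aut (g σ) = σ := by
    choose g hg using d.ε_surjective
    exact ⟨fun σ => g (.ofMul σ), fun σ => congrArg Additive.toMul (hg _)⟩
  let e := LinearEquiv.ofBijective _
    (sumMonomial_bijective hg (Module.finBasis F (centralizerOf ι)))
  refine ⟨Module.Finite.equiv e, ?_⟩
  rw [← e.finrank_eq, Module.finrank_fintype_fun_eq_card, Fintype.card_prod, Fintype.card_fin,
    finrank_eq_mul_finrank_centralizerOf ι, Fintype.card_eq_nat_card,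
    IsGalois.card_aut_eq_finrank]

omit [FiniteDimensional F A] in
-- Commuting with the monomials makes each Hahn coefficient commute with every `u σ * r`. Such
-- elements span `A`, so the coefficient lies in `F`.
lemma isCentral : Algebra.IsCentral (HahnSeries d.ε.ker F) (MalcevNeumannRing d) where
  out f hf := by
    have hcomm (γ δ : Γ) (r : centralizerOf ι) :
        f.toHahn.coeff γ * (d.unit δ * (r : A)) = d.unit δ * r * f.toHahn.coeff γ := by
      have h := congrArg toHahn ((Subalgebra.mem_center_iff.1 hf (monomial d δ r)))
      rw [toHahn_mul, toHahn_mul, toHahn_monomial] at h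
      have h' := congrArg (fun x => HahnSeries.coeff x (γ + δ)) h
      simp only [HahnSeries.coeff_mul_single_add] at h'
      rw [← h', HahnSeries.coeff_single_mul_add]
    have hF (γ : Γ) : ∃ c : F, algebraMap F A c = f.toHahn.coeff γ := by
      have h : f.toHahn.coeff γ ∈ Subalgebra.center F A := by
        rw [Subalgebra.mem_center_iff]
        intro a
        obtain ⟨c, rfl⟩ := (sumUnitMul_bijective ι (u := fun σ => d.u σ)
          (fun σ => (d.u σ).ne_zero) fun σ x => by
            rw [d.conj_u, ← mul_assoc, ← mul_assoc, Units.mul_inv, one_mul]).2 a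
        change (∑ σ, _) * _ = _ * ∑ σ, _
        rw [Finset.sum_mul, Finset.mul_sum]
        refine Finset.sum_congr rfl fun σ _ => ?_
        obtain ⟨δ, hδ⟩ := d.ε_surjective (.ofMul σ)
        have : d.unit δ = d.u σ := congrArg d.u (congrArg Additive.toMul hδ)
        change (d.u σ : A) * _ * _ = _ * ((d.u σ : A) * _)
        rw [← this, hcomm]
      rw [Algebra.IsCentral.center_eq_bot, Algebra.mem_bot] at h
      exact h
    choose c hc using hF
    -- A nonzero coefficient `u_{ε(γ)} r` induces `ε(γ)` on `K`, yet as a scalar it commutes with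
    -- `K`; so `ε(γ)` is trivial.
    have hker (γ : Γ) (hγ : γ ∉ d.ε.ker) : f.coeff γ = 0 := by
      by_contra hne
      have hne : (f.coeff γ : A) ≠ 0 := fun h => hne (Subtype.ext h)
      refine hγ (mem_ker_iff.2 (AlgEquiv.ext fun x => ι.toRingHom.injective ?_))
      have h1 : ι x * f.toHahn.coeff γ = f.toHahn.coeff γ * ι x := by
        rw [← hc, Algebra.commutes]
      have h2 : ι (d.aut γ x) * (f.coeff γ : A) = f.coeff γ * ι (d.aut γ x) :=
        mem_centralizerOf_iff.1 (f.coeff γ).2 _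
      have h3 : f.toHahn.coeff γ * ι (d.aut γ x) = f.toHahn.coeff γ * ι x := by
        rw [← h1, toHahn_coeff, mul_assoc, ← h2, ← mul_assoc, ← mul_assoc, map_mul_unit]
      refine mul_left_cancel₀ ?_ h3
      rw [toHahn_coeff]
      exact mul_ne_zero (d.unit γ).ne_zero hne
    rw [Algebra.mem_bot]
    refine ⟨⟨fun κ => c κ, ?_⟩, toHahn_injective ?_⟩
    · rw [Set.isPWO_iff_exists_monotone_subseq]
      intro u hu
      obtain ⟨φ, hφ⟩ := f.isPWO_supp.exists_monotone_subseq (f := fun n => (u n : Γ)) fun n hn => by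
        refine hu n ((algebraMap F A).injective ?_)
        rw [hc, toHahn_coeff, hn, map_zero, ZeroMemClass.coe_zero, mul_zero]
      exact ⟨φ, fun m n hmn => hφ hmn⟩
    · ext γ
      by_cases h : γ ∈ d.ε.ker
      · rw [toHahn_algebraMap_coeff _ ⟨γ, h⟩, ← hc]
      · rw [toHahn_algebraMap_coeff_of_notMem _ h, toHahn_coeff, hker γ h, ZeroMemClass.coe_zero,
          mul_zero]

/-- The Mal'cev-Neumann ring of a finite-dimensional central division algebra is a division
ring. -/
noncomputable abbrev divisionRing : DivisionRing (MalcevNeumannRing d) :=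
  have := (finite_and_finrank_eq d).1
  .ofIsUnitOrEqZero fun _ => or_iff_not_imp_right.2 fun h =>
    FiniteDimensional.isUnit (HahnSeries d.ε.ker F) h

end Division

end MalcevNeumannRing

/-! ### Composita and degrees of Galois subfields -/

section Compositum

variable {F A : Type*} [Field F] [DivisionRing A] [Algebra F A] [FiniteDimensional F A]
  {k K : Type*} [Field k] [Algebra F k] [IsGalois F k] [Field K] [Algebra F K] [IsGalois F K]

/-- The compositum of two commuting Galois subfields is a Galois subfield. -/
lemma exists_isGaloisField_of_commute (ρ : k →ₐ[F] A) (ι : K →ₐ[F] A)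
    (h : ∀ x y, ρ x * ι y = ι y * ρ x) :
    ∃ L : Subalgebra F A, ρ.range ≤ L ∧ ι.range ≤ L ∧ L.IsGaloisField := by
  let s : Set A := Set.range ρ ∪ Set.range ι
  have hcomm : ∀ x ∈ s, ∀ y ∈ s, x * y = y * x := by
    rintro _ (⟨x, rfl⟩ | ⟨x, rfl⟩) _ (⟨y, rfl⟩ | ⟨y, rfl⟩)
    · exact (map_mul ρ x y).symm.trans ((congrArg ρ (mul_comm x y)).trans (map_mul ρ y x))
    · exact h x y
    · exact (h y x).symm
    · exact (map_mul ι x y).symm.trans ((congrArg ι (mul_comm x y)).trans (map_mul ι y x))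
  have hmul := (Algebra.isMulCommutative_adjoin F hcomm).is_comm.comm
  let L := Algebra.adjoin F s
  have hfield : IsField L := L.isField_of_comm fun x hx y hy =>
    congrArg Subtype.val (hmul ⟨x, hx⟩ ⟨y, hy⟩)
  have hρ : ρ.range ≤ L := by
    rintro _ ⟨x, rfl⟩
    exact Algebra.subset_adjoin (Or.inl ⟨x, rfl⟩)
  have hι : ι.range ≤ L := by
    rintro _ ⟨x, rfl⟩
    exact Algebra.subset_adjoin (Or.inr ⟨x, rfl⟩)
  refine ⟨L, hρ, hι, hfield, ?_⟩
  let := hfield.toField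
  let ρ' : k →ₐ[F] L := ρ.codRestrict L fun x => hρ ⟨x, rfl⟩
  let ι' : K →ₐ[F] L := ι.codRestrict L fun x => hι ⟨x, rfl⟩
  have : IsGalois F ρ'.fieldRange := .of_algEquiv (AlgEquiv.ofInjectiveField ρ')
  have : IsGalois F ι'.fieldRange := .of_algEquiv (AlgEquiv.ofInjectiveField ι')
  have hsup : IsGalois F (ρ'.fieldRange ⊔ ι'.fieldRange : IntermediateField F L) := ⟨⟩
  -- `L` is generated by the two images, so it is their join, and joins of Galois extensions are
  -- Galois.
  have htop : ρ'.fieldRange ⊔ ι'.fieldRange = ⊤ := by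
    have hle : L ≤ (ρ'.fieldRange ⊔ ι'.fieldRange).toSubalgebra.map L.val := by
      refine Algebra.adjoin_le ?_
      rintro _ (⟨x, rfl⟩ | ⟨x, rfl⟩)
      · exact ⟨ρ' x, (le_sup_left : ρ'.fieldRange ≤ _) ⟨x, rfl⟩, rfl⟩
      · exact ⟨ι' x, (le_sup_right : ι'.fieldRange ≤ _) ⟨x, rfl⟩, rfl⟩
    refine top_unique fun x _ => ?_
    obtain ⟨y, hy, hyx⟩ := hle x.2
    rwa [← Subtype.ext hyx]
  rw [htop] at hsup
  exact .of_algEquiv (IntermediateField.topEquiv (F := F) (E := L))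

end Compositum

section GaloisFieldDegree

variable {F A : Type*} [Field F] [DivisionRing A] [Algebra F A] [FiniteDimensional F A]
  [Algebra.IsCentral F A]

/-- The degree of a Galois subfield divides the dimension of the algebra, and its square is at most
the dimension. -/
lemma Subalgebra.IsGaloisField.finrank_sq_le {L : Subalgebra F A} (h : L.IsGaloisField) :
    Module.finrank F L ∣ Module.finrank F A ∧ Module.finrank F L ^ 2 ≤ Module.finrank F A := by
  obtain ⟨hL, hgal⟩ := h
  let := hL.toField
  have h1 := finrank_eq_mul_finrank_centralizerOf (F := F) (K := L) L.val
  have h2 : L ≤ centralizerOf (K := L) L.val := fun x hx =>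
    mem_centralizerOf_iff.2 fun y => congrArg Subtype.val (mul_comm y (⟨x, hx⟩ : L))
  refine ⟨⟨_, h1⟩, ?_⟩
  rw [sq]
  exact (Nat.mul_le_mul_left _ (Submodule.finrank_mono
    (s := Subalgebra.toSubmodule L) (t := Subalgebra.toSubmodule (centralizerOf L.val)) h2)).trans_eq
    h1.symm

/-- A Galois subfield containing a subfield of prime degree `p` in an algebra of degree `p ^ 2` has
degree `p ^ 2` or is equal to the subfield. -/
lemma Subalgebra.IsGaloisField.eq_of_finrank_ne {p : ℕ} (hp : p.Prime)
    (hA : Module.finrank F A = (p ^ 2) ^ 2) {L K : Subalgebra F A} (h : L.IsGaloisField)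
    (hKL : K ≤ L) (hK : Module.finrank F K = p) (hL : Module.finrank F L ≠ p ^ 2) : K = L := by
  obtain ⟨h1, h2⟩ := h.finrank_sq_le
  have h3 : Module.finrank F K ≤ Module.finrank F L := Submodule.finrank_mono
    (s := Subalgebra.toSubmodule K) (t := Subalgebra.toSubmodule L) hKL
  rw [hA] at h1 h2
  have h4 : Module.finrank F L ≤ p ^ 2 := (Nat.pow_le_pow_iff_left two_ne_zero).1 h2
  rw [← pow_mul, Nat.dvd_prime_pow hp] at h1
  obtain ⟨i, -, hi⟩ := h1
  rw [hi, Nat.pow_le_pow_iff_right hp.one_lt] at h4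
  refine Subalgebra.eq_of_le_of_finrank_eq hKL ?_
  -- The degree is a power of `p` that is at least `p` and at most `p ^ 2`.
  interval_cases i
  · rw [hK, hi, pow_zero] at h3
    exact absurd h3 (not_le.2 hp.one_lt)
  · rw [hK, hi, pow_one]
  · exact absurd hi hL

end GaloisFieldDegree

/-! ### Residue fields of subfields of the Mal'cev–Neumann ring -/

section

open IsLocalRing

/-- The coefficient of a product at the sum of lower bounds of the orders. -/
lemma HahnSeries.coeff_add_mul_of_le_orderTop {Γ R : Type*} [AddCommGroup Γ] [LinearOrder Γ]
    [IsOrderedAddMonoid Γ] [Ring R] {f g : HahnSeries Γ R} {a b : Γ} (hf : a ≤ f.orderTop)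
    (hg : b ≤ g.orderTop) : (f * g).coeff (a + b) = f.coeff a * g.coeff b := by
  rw [HahnSeries.coeff_mul, Finset.sum_subset (s₂ := {(a, b)})]
  · simp
  · intro p hp
    obtain ⟨h1, h2, h3⟩ := Finset.mem_antidiagonal.1 hp
    have h1 := WithTop.coe_le_coe.1 (hf.trans (HahnSeries.orderTop_le_of_coeff_ne_zero h1))
    have h2 := WithTop.coe_le_coe.1 (hg.trans (HahnSeries.orderTop_le_of_coeff_ne_zero h2))
    obtain ⟨h4, h5⟩ := (add_eq_add_iff_eq_and_eq h1 h2).1 h3.symm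
    rw [Finset.mem_singleton, Prod.ext_iff]
    exact ⟨h4.symm, h5.symm⟩
  · intro p hp hp'
    rw [Finset.mem_singleton] at hp
    subst hp
    simp only [Finset.mem_antidiagonal, HahnSeries.mem_support, and_true, not_and_or,
      not_not] at hp'
    rcases hp' with h | h <;> simp [h]

namespace MalcevNeumannRing

open MalcevNeumannDatum

variable {F K A : Type*} [Field F] [Field K] [Algebra F K] [DivisionRing A] [Algebra F A]
  {ι : K →ₐ[F] A} {Γ : Type*} [AddCommGroup Γ] [LinearOrder Γ] [IsOrderedAddMonoid Γ]
  (d : MalcevNeumannDatum ι Γ)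

/-- The valuation of the Mal'cev-Neumann ring given by the order of a series. -/
noncomputable def orderVal : Valuation (MalcevNeumannRing d) (Multiplicative (WithTop Γ)ᵒᵈ) :=
  (HahnSeries.addVal Γ A).comap (toHahnHom d)

variable {d}

lemma orderVal_eq_iff (f g : MalcevNeumannRing d) :
    orderVal d f = orderVal d g ↔ f.toHahn.orderTop = g.toHahn.orderTop := Iff.rfl

lemma toHahn_ne_zero {f : MalcevNeumannRing d} (hf : f ≠ 0) : f.toHahn ≠ 0 := fun h =>
  hf (toHahn_injective (h.trans toHahn_zero.symm))

lemma toHahn_coeff_zero_mul {f g : MalcevNeumannRing d} (hf : 0 ≤ f.toHahn.orderTop)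
    (hg : 0 ≤ g.toHahn.orderTop) :
    (f * g).toHahn.coeff 0 = f.toHahn.coeff 0 * g.toHahn.coeff 0 := by
  rw [toHahn_mul, ← HahnSeries.coeff_add_mul_of_le_orderTop hf hg, add_zero]

omit [LinearOrder Γ] [IsOrderedAddMonoid Γ] in
lemma aut_nsmul (n : ℕ) (γ : Γ) : d.aut (n • γ) = d.aut γ ^ n := by
  simp [aut]

section Subfield

variable {M : Type*} [Field M] [Algebra (HahnSeries d.ε.ker F) M]
  (j : M →ₐ[HahnSeries d.ε.ker F] MalcevNeumannRing d)

/-- The order valuation of a subfield. -/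
noncomputable abbrev subfieldVal : Valuation M (Multiplicative (WithTop Γ)ᵒᵈ) :=
  (orderVal d).comap (j : M →+* MalcevNeumannRing d)

lemma mem_valuationSubring_subfieldVal_iff (x : M) :
    x ∈ (subfieldVal j).valuationSubring ↔ 0 ≤ (j x).toHahn.orderTop := Iff.rfl

/-- The constant coefficient of an element of nonnegative order of a subfield. -/
noncomputable def constCoeff : (subfieldVal j).valuationSubring →+* A where
  toFun x := (j x).toHahn.coeff 0
  map_one' := by simp [toHahn_one]
  map_mul' x y := by
    rw [MulMemClass.coe_mul, map_mul]
    exact toHahn_coeff_zero_mul x.2 y.2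
  map_zero' := by simp [toHahn_zero]
  map_add' x y := by simp [toHahn_add]

lemma constCoeff_eq_zero_of_mem {x : (subfieldVal j).valuationSubring}
    (hx : x ∈ maximalIdeal (subfieldVal j).valuationSubring) : constCoeff j x = 0 := by
  rw [Valuation.mem_maximalIdeal_iff, Valuation.comap_apply] at hx
  exact HahnSeries.coeff_eq_zero_of_lt_orderTop hx

/-- The embedding of the residue field of a subfield in `A`. -/
noncomputable def residueHom : (subfieldVal j).Residue →+* A :=
  Ideal.Quotient.lift _ (constCoeff j) fun _ hx => constCoeff_eq_zero_of_mem j hx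

lemma residueHom_residue (x : (subfieldVal j).valuationSubring) :
    residueHom j (residue _ x) = (j x).toHahn.coeff 0 := rfl

/-- At index `0` the unit is `1`, so the Hahn coefficient is the original one. This is why the
residue field commutes with `K` and a compositum can be formed. -/
lemma residueHom_mem (y : (subfieldVal j).Residue) : residueHom j y ∈ centralizerOf ι := by
  obtain ⟨x, rfl⟩ := residue_surjective y
  rw [residueHom_residue, toHahn_coeff_zero]
  exact ((j x).coeff 0).2

lemma toHahn_map_algebraMap_single (κ : d.ε.ker) (c : F) :
    (j (algebraMap _ M (HahnSeries.single κ c))).toHahn =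
      HahnSeries.single (κ : Γ) (algebraMap F A c) := by
  rw [AlgHom.commutes]
  ext γ
  by_cases h : γ ∈ d.ε.ker
  · rw [toHahn_algebraMap_coeff _ ⟨γ, h⟩, HahnSeries.coeff_single, HahnSeries.coeff_single]
    simp only [Subtype.ext_iff]
    split_ifs <;> simp
  · rw [toHahn_algebraMap_coeff_of_notMem _ h, HahnSeries.coeff_single_of_ne]
    rintro rfl
    exact h κ.2

/-- The scalars of the residue field of a subfield. -/
noncomputable def scalarHom : F →+* (subfieldVal j).valuationSubring :=
  ((algebraMap (HahnSeries d.ε.ker F) M).comp HahnSeries.C).codRestrict _ fun c => by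
    rw [mem_valuationSubring_subfieldVal_iff, RingHom.comp_apply, HahnSeries.C_apply,
      toHahn_map_algebraMap_single]
    exact HahnSeries.orderTop_single_le

lemma coe_scalarHom (c : F) :
    (scalarHom j c : M) = algebraMap (HahnSeries d.ε.ker F) M (HahnSeries.single 0 c) := rfl

noncomputable instance : Algebra F (subfieldVal j).Residue :=
  ((residue _).comp (scalarHom j)).toAlgebra

lemma algebraMap_residue (c : F) :
    algebraMap F (subfieldVal j).Residue c = residue _ (scalarHom j c) := rfl

/-- The embedding of the residue field of a subfield in `A`, as an algebra homomorphism. -/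
noncomputable def residueAlgHom : (subfieldVal j).Residue →ₐ[F] A :=
  { residueHom j with
    commutes' := fun c => by
      change residueHom j (residue _ (scalarHom j c)) = _
      rw [residueHom_residue, coe_scalarHom, toHahn_map_algebraMap_single, ZeroMemClass.coe_zero,
        HahnSeries.coeff_single_same] }

lemma residueAlgHom_residue (x : (subfieldVal j).valuationSubring) :
    residueAlgHom j (residue _ x) = (j x).toHahn.coeff 0 := rfl

lemma residueAlgHom_mem (y : (subfieldVal j).Residue) : residueAlgHom j y ∈ centralizerOf ι :=
  residueHom_mem j y

variable {j} in
/-- Elements of value in `ker ε` have the value of a scalar. -/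
lemma subfieldVal_algebraMap_single_eq {x : M} {κ : d.ε.ker}
    (h : (j x).toHahn.orderTop = ((κ : Γ) : WithTop Γ)) :
    subfieldVal j (algebraMap _ M (HahnSeries.single κ (1 : F))) = subfieldVal j x := by
  rw [Valuation.comap_apply, Valuation.comap_apply]
  refine (orderVal_eq_iff _ _).2 ?_
  refine Eq.trans ?_ h.symm
  refine (congrArg HahnSeries.orderTop (toHahn_map_algebraMap_single j κ (1 : F))).trans ?_
  rw [map_one, HahnSeries.orderTop_single one_ne_zero]

section Galois

variable [(subfieldVal j).IsInvariant (M ≃ₐ[HahnSeries d.ε.ker F] M)]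

lemma smul_algebraMap_residue (g : M ≃ₐ[HahnSeries d.ε.ker F] M) (c : F) :
    g • algebraMap F (subfieldVal j).Residue c = algebraMap F (subfieldVal j).Residue c := by
  rw [algebraMap_residue, ← ResidueField.residue_smul]
  congr 1
  exact Subtype.ext (g.commutes _)

variable [FiniteDimensional (HahnSeries d.ε.ker F) M] [IsGalois (HahnSeries d.ε.ker F) M]

variable {j} in
-- Averaging lifts a fixed residue to a series in `F((ker ε))`, whose constant coefficient lies in
-- `F`.
lemma exists_algebraMap_residue_eq
    (hn : (Module.finrank (HahnSeries d.ε.ker F) M : (subfieldVal j).Residue) ≠ 0)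
    {y : (subfieldVal j).Residue} (hy : ∀ g : M ≃ₐ[HahnSeries d.ε.ker F] M, g • y = y) :
    ∃ c : F, algebraMap F (subfieldVal j).Residue c = y := by
  rw [← IsGalois.card_aut_eq_finrank] at hn
  obtain ⟨z, hz, rfl⟩ := Valuation.exists_fixed_residue_eq _ hn y hy
  obtain ⟨ζ, hζ⟩ := (IsGalois.mem_range_algebraMap_iff_fixed (F := HahnSeries d.ε.ker F)
    (z : M)).2 fun g => congrArg Subtype.val (hz g)
  refine ⟨ζ.coeff 0, (residueAlgHom j).toRingHom.injective ?_⟩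
  change residueAlgHom j _ = residueAlgHom j _
  rw [AlgHom.commutes, residueAlgHom_residue, ← hζ, AlgHom.commutes]
  exact (toHahn_algebraMap_coeff ζ 0).symm

/-- By Artin's theorem the residue field is Galois over the fixed field of the group, and that fixed
field is `F`. -/
lemma isGalois_residue
    (hn : (Module.finrank (HahnSeries d.ε.ker F) M : (subfieldVal j).Residue) ≠ 0) :
    IsGalois F (subfieldVal j).Residue := by
  let G := M ≃ₐ[HahnSeries d.ε.ker F] M
  let φ : F →+* FixedPoints.subfield G (subfieldVal j).Residue :=
    (algebraMap F (subfieldVal j).Residue).codRestrict _ fun c g => smul_algebraMap_residue j g c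
  have hφ : Function.Bijective φ := by
    refine ⟨φ.injective, fun y => ?_⟩
    obtain ⟨c, hc⟩ := exists_algebraMap_residue_eq hn y.2
    exact ⟨c, Subtype.ext hc⟩
  have : IsGalois (FixedPoints.subfield G (subfieldVal j).Residue) (subfieldVal j).Residue := ⟨⟩
  refine IsGalois.of_equiv_equiv (F := FixedPoints.subfield G (subfieldVal j).Residue)
    (E := (subfieldVal j).Residue) (f := (RingEquiv.ofBijective φ hφ).symm)
    (g := RingEquiv.refl _) ?_
  ext y
  obtain ⟨c, rfl⟩ := hφ.2 y
  change algebraMap F _ ((RingEquiv.ofBijective φ hφ).symm (RingEquiv.ofBijective φ hφ c)) = _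
  rw [RingEquiv.symm_apply_apply]
  rfl

instance : SMulCommClass (M ≃ₐ[HahnSeries d.ε.ker F] M) F (subfieldVal j).Residue where
  smul_comm g c y := by
    rw [Algebra.smul_def, Algebra.smul_def, smul_mul', smul_algebraMap_residue]

variable {p : ℕ} [IsGalois F K]

/-- If a series of order outside the kernel of `ε` commutes with an integral series whose constant
coefficient is in `K`, then this coefficient is in `F`. -/
lemma exists_algebraMap_eq_of_commute (hp : (Module.finrank F K).Prime) {f g : MalcevNeumannRing d}
    (h : f * g = g * f) (hf : 0 ≤ f.toHahn.orderTop) {a : K} (ha : f.toHahn.coeff 0 = ι a)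
    {γ : Γ} (hγ : g.toHahn.orderTop = γ) (hγ0 : g.toHahn.coeff γ ≠ 0) (hker : γ ∉ d.ε.ker) :
    ∃ c : F, algebraMap F K c = a := by
  have := Fact.mk hp
  have : FiniteDimensional F K := .of_finrank_pos hp.pos
  -- Compare the coefficients of `f * g` and `g * f` at `γ`: `a` commutes with a leading coefficient
  -- that induces `ε(γ)` on `K`.
  have h1 : ι a * g.toHahn.coeff γ = g.toHahn.coeff γ * ι a := by
    rw [← ha, ← HahnSeries.coeff_add_mul_of_le_orderTop hf hγ.ge,
      ← HahnSeries.coeff_add_mul_of_le_orderTop hγ.ge hf, zero_add, add_zero, ← toHahn_mul,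
      ← toHahn_mul, h]
  have h2 : ι (d.aut γ a) * (g.coeff γ : A) = g.coeff γ * ι (d.aut γ a) :=
    mem_centralizerOf_iff.1 (g.coeff γ).2 _
  have h3 : d.aut γ a = a := by
    refine ι.toRingHom.injective (mul_left_cancel₀ hγ0 (Eq.trans ?_ h1))
    change g.toHahn.coeff γ * ι _ = _
    rw [toHahn_coeff, mul_assoc, ← h2, ← mul_assoc, ← mul_assoc, map_mul_unit]
  refine (IsGalois.mem_range_algebraMap_iff_fixed a).2 fun σ => ?_
  -- The nontrivial automorphism `ε(γ)` generates a group of prime order, so fixing `a` puts `a` in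
  -- `F`.
  obtain ⟨n, rfl⟩ := mem_powers_of_prime_card (IsGalois.card_aut_eq_finrank F K)
    (mt mem_ker_iff.2 hker) (g' := σ)
  change (d.aut γ ^ n) a = a
  induction n with
  | zero => rfl
  | succ n ih => rw [pow_succ, AlgEquiv.mul_apply, h3, ih]

/-- The residue field of a Galois subfield of degree `p ^ 2` is not contained in `K`. -/
lemma not_residueAlgHom_range_le (hp : p.Prime) (hK : Module.finrank F K = p) (hpF : (p : F) ≠ 0)
    (hM : Module.finrank (HahnSeries d.ε.ker F) M = p ^ 2) :
    ¬ (residueAlgHom j).range ≤ ι.range := by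
  classical
  intro hle
  have := Fact.mk hp
  have hKfin : FiniteDimensional F K := .of_finrank_pos (hK ▸ hp.pos)
  let w := subfieldVal j
  let G := M ≃ₐ[HahnSeries d.ε.ker F] M
  have hcardK : Nat.card (K ≃ₐ[F] K) = p := by rw [IsGalois.card_aut_eq_finrank, hK]
  have hcardG : Nat.card G = p ^ 2 := by rw [IsGalois.card_aut_eq_finrank, hM]
  have hp2 : p < p ^ 2 := lt_self_pow₀ hp.one_lt one_lt_two
  have hp2k : ((p ^ 2 : ℕ) : w.Residue) ≠ 0 := by
    rw [← map_natCast (algebraMap F w.Residue), Nat.cast_pow]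
    exact (map_ne_zero _).2 (pow_ne_zero _ hpF)
  have hpow (g : G) : g ^ (p ^ 2) = 1 := by rw [← hcardG, pow_card_eq_one']
  have hjinj : Function.Injective j := RingHom.injective (j : M →+* MalcevNeumannRing d)
  have hex : ∀ x ≠ 0, ∃ γ : Γ, (j x).toHahn.orderTop = γ ∧ (j x).toHahn.coeff γ ≠ 0 := by
    intro x hx
    have h0 : (j x).toHahn ≠ 0 := toHahn_ne_zero ((map_ne_zero_iff j hjinj).2 hx)
    refine ⟨(j x).toHahn.order, (HahnSeries.order_eq_orderTop_of_ne_zero h0).symm, ?_⟩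
    exact HahnSeries.coeff_order_eq_zero.not.2 h0
  -- An order in `ker ε` is already the value of a scalar monomial, which the Galois group fixes.
  have hone {τ : G} (hτ : ∀ y : w.Residue, τ • y = y) {x : M} {γ : Γ}
      (hγ : (j x).toHahn.orderTop = γ) (hker : γ ∈ d.ε.ker) : w.tameChar τ x = 1 := by
    have h := subfieldVal_algebraMap_single_eq (κ := ⟨γ, hker⟩) hγ
    have hne : algebraMap (HahnSeries d.ε.ker F) M (HahnSeries.single ⟨γ, hker⟩ 1) ≠ 0 :=
      (map_ne_zero _).2 (by simp)
    rw [← Valuation.tameChar_congr hτ hne h]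
    exact Valuation.tameChar_of_fixed hne (τ.commutes _)
  -- The residue degree is at most `p`, too small for a faithful action of `p ^ 2` automorphisms. A
  -- nontrivial inertia element has a nontrivial tame character, which must be seen on an order
  -- outside `ker ε`.
  obtain ⟨x, hx0, γ, hγ, hγ0, hγker⟩ : ∃ x : M, x ≠ 0 ∧ ∃ γ : Γ,
      (j x).toHahn.orderTop = γ ∧ (j x).toHahn.coeff γ ≠ 0 ∧ γ ∉ d.ε.ker := by
    let ψ : w.Residue →ₐ[F] K := (AlgEquiv.ofInjectiveField ι).symm.toAlgHom.comp
      ((Subalgebra.inclusion hle).comp (residueAlgHom j).rangeRestrict)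
    have hψ : Function.Injective ψ.toLinearMap := RingHom.injective (ψ : w.Residue →+* K)
    have hfin : FiniteDimensional F w.Residue := Module.Finite.of_injective _ hψ
    have hdeg : Module.finrank F w.Residue ≤ p :=
      (LinearMap.finrank_le_finrank_of_injective hψ).trans_eq hK
    let φ := MulSemiringAction.toAlgAut G F w.Residue
    have hφ : ¬ Function.Injective φ := fun h => by
      have h1 := Nat.card_le_card_of_injective φ h
      rw [hcardG, Nat.card_eq_fintype_card] at h1
      exact absurd (h1.trans (AlgEquiv.card_le.trans hdeg)) (not_le.2 hp2)
    rw [← MonoidHom.ker_eq_bot_iff, ← Ne, Subgroup.ne_bot_iff_exists_ne_one] at hφ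
    obtain ⟨⟨τ, hτ⟩, hτ1⟩ := hφ
    have hτ1 : τ ≠ 1 := fun h => hτ1 (Subtype.ext h)
    have htriv (y : w.Residue) : τ • y = y := AlgEquiv.congr_fun (MonoidHom.mem_ker.1 hτ) y
    by_contra! h
    refine hτ1 (AlgEquiv.ext fun y =>
      Valuation.smul_eq_of_tameChar_eq_one (w := w) (hpow τ) hp2k (fun x hx => ?_) y)
    obtain ⟨γ, hγ, hγ0⟩ := hex x hx
    exact hone htriv hγ (h x hx γ hγ hγ0)
  -- Residues lie in `K` and commute with the leading coefficient of `x`, so they lie in `F`: the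
  -- whole group is inertia.
  have htriv (g : G) (y : w.Residue) : g • y = y := by
    obtain ⟨z, hz⟩ := residue_surjective y
    obtain ⟨a, ha⟩ := hle ⟨y, rfl⟩
    have ha : ι a = residueAlgHom j y := ha
    rw [← hz, residueAlgHom_residue] at ha
    obtain ⟨c, rfl⟩ := exists_algebraMap_eq_of_commute (hK ▸ hp)
      (f := j z) (g := j x) (by rw [← map_mul, mul_comm, map_mul]) z.2 ha.symm hγ hγ0 hγker
    have hy : y = algebraMap F w.Residue c := by
      refine RingHom.injective (residueAlgHom j : w.Residue →+* A) ?_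
      change residueAlgHom j y = residueAlgHom j _
      rw [AlgHom.commutes, ← hz, residueAlgHom_residue, ← ha, AlgHom.commutes]
    rw [hy, smul_algebraMap_residue]
  have horder (n : ℕ) : (j (x ^ n)).toHahn.orderTop = ((n • γ : Γ) : WithTop Γ) := by
    induction n with
    | zero => simp [toHahn_one]
    | succ n ih =>
      rw [pow_succ, map_mul, toHahn_mul, HahnSeries.orderTop_mul, ih, hγ, succ_nsmul,
        WithTop.coe_add]
  -- Since `Γ / ker ε` has order `p`, every order is a multiple of `γ` modulo `ker ε`; the character
  -- at `x` therefore determines `g`.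
  have hinj (g : G) (hg : w.tameChar g x = 1) : g = 1 := by
    refine AlgEquiv.ext fun y =>
      Valuation.smul_eq_of_tameChar_eq_one (w := w) (hpow g) hp2k (fun x' hx' => ?_) y
    obtain ⟨γ₁, hγ₁, -⟩ := hex x' hx'
    obtain ⟨n, hn⟩ := mem_powers_of_prime_card hcardK (mt mem_ker_iff.2 hγker) (g' := d.aut γ₁)
    have hn : d.aut γ ^ n = d.aut γ₁ := hn
    have hxn : x ^ n ≠ 0 := pow_ne_zero n hx0
    obtain ⟨γ₂, hγ₂, -⟩ := hex (x' / x ^ n) (div_ne_zero hx' hxn)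
    have hmul : x' = x' / x ^ n * x ^ n := (div_mul_cancel₀ x' hxn).symm
    have hsum : γ₁ = γ₂ + n • γ := by
      rw [hmul, map_mul, toHahn_mul, HahnSeries.orderTop_mul, hγ₂, horder] at hγ₁
      exact_mod_cast hγ₁.symm
    have hγ₂ker : γ₂ ∈ d.ε.ker := by
      rw [mem_ker_iff]
      have h := d.aut_add γ₂ (n • γ)
      rwa [← hsum, aut_nsmul, hn, right_eq_mul] at h
    rw [hmul, Valuation.tameChar_mul, hone (htriv g) hγ₂ hγ₂ker, one_mul, Valuation.tameChar_pow,
      hg, one_pow]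
  have hmul (g h : G) : w.tameChar (g * h) x = w.tameChar g x * w.tameChar h x := by
    rw [Valuation.tameChar_mul_left w g h hx0, Valuation.tameChar_congr (htriv g)
      ((smul_ne_zero_iff_ne h).2 hx0) (Valuation.IsInvariant.map_smul h x)]
  -- The order `p • γ` of `x ^ p` lies in `ker ε`, so character values at `x` are `p`-th roots of
  -- unity, of which a field has at most `p`.
  have hroot (g : G) : w.tameChar g x ∈ (Polynomial.nthRoots p (1 : w.Residue)).toFinset := by
    rw [Multiset.mem_toFinset, Polynomial.mem_nthRoots hp.pos, ← Valuation.tameChar_pow]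
    refine hone (htriv g) (horder p) ?_
    rw [mem_ker_iff, aut_nsmul, ← hcardK, pow_card_eq_one']
  have hle : Nat.card G ≤ p := by
    have h := Nat.card_le_card_of_injective (β := (Polynomial.nthRoots p (1 : w.Residue)).toFinset)
      (fun g : G => ⟨_, hroot g⟩) fun g h hgh => by
        have hgh : w.tameChar g x = w.tameChar h x := congrArg Subtype.val hgh
        have h1 := hmul h (h⁻¹ * g)
        rw [mul_inv_cancel_left, hgh] at h1
        have h2 := hinj _ (mul_left_cancel₀ (w.tameChar_ne_zero h hx0)
          (h1.symm.trans (mul_one _).symm))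
        exact (inv_mul_eq_one.1 h2).symm
    rw [Nat.card_eq_finsetCard] at h
    exact h.trans ((Multiset.toFinset_card_le _).trans (Polynomial.card_nthRoots p _))
  exact absurd (hcardG ▸ hle) (not_le.2 hp2)

end Galois

end Subfield

end MalcevNeumannRing

end

/-! ### Invertibility of `p` and assembly of the theorem -/

lemma Valuation.natCast_residue_ne_zero_of_ringChar {F Λ : Type*} [Field F]
    [LinearOrderedCommGroupWithZero Λ] (v : Valuation F Λ) {p : ℕ} (hp : p.Prime)
    (h : ringChar v.Residue ≠ p) : (p : v.Residue) ≠ 0 := fun h0 =>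
  ((Nat.dvd_prime hp).1 (ringChar.dvd h0)).elim CharP.ringChar_ne_one h

/-- If `p` vanished in `k`, then `1` would have additive order `p`, which divides the cardinality.
-/
lemma natCast_ne_zero_of_card {k : Type*} [Field k] [Finite k] {p : ℕ} (hp : p.Prime)
    (h : ¬ Nat.card k ≡ 0 [MOD p]) : (p : k) ≠ 0 := fun h0 => by
  have := Fact.mk hp
  have h1 : addOrderOf (1 : k) = p := addOrderOf_eq_prime (by simpa using h0) one_ne_zero
  exact h (Nat.modEq_zero_iff_dvd.2 (h1 ▸ addOrderOf_dvd_natCard 1))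

lemma Valuation.natCast_ne_zero {F Λ : Type*} [Field F]
    [LinearOrderedCommGroupWithZero Λ] (v : Valuation F Λ) {p : ℕ}
    (h : (p : v.Residue) ≠ 0) : (p : F) ≠ 0 := fun h0 => h <| by
  rw [← map_natCast (IsLocalRing.residue v.valuationSubring), ← map_zero (IsLocalRing.residue _)]
  congr 1
  exact Subtype.ext (by simpa using h0)

namespace MalcevNeumannRing

variable {F K A : Type*} [Field F] [Field K] [Algebra F K] [DivisionRing A] [Algebra F A]
  {ι : K →ₐ[F] A} {Γ : Type*} [AddCommGroup Γ] [LinearOrder Γ] [IsOrderedAddMonoid Γ]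
  (d : MalcevNeumannDatum ι Γ) [FiniteDimensional F A] [Algebra.IsCentral F A] [IsGalois F K]
  {p : ℕ}

/-- If no Galois subfield of `A` of degree `p ^ 2` contains `K`, then the Mal'cev-Neumann ring is
a noncrossed product. -/
theorem isNoncrossedProductDivisionAlgebra (hp : p.Prime)
    (hA : Module.finrank F A = (p ^ 2) ^ 2) (hK : Module.finrank F K = p) (hpF : (p : F) ≠ 0)
    (h : ∀ L : Subalgebra F A, ι.range ≤ L → L.IsGaloisField → Module.finrank F L ≠ p ^ 2) :
    IsNoncrossedProductDivisionAlgebra (HahnSeries d.ε.ker F) (MalcevNeumannRing d) := by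
  have hKfin : FiniteDimensional F K := .of_finrank_pos (hK ▸ hp.pos)
  have hfin := (finite_and_finrank_eq d).1
  have hcen := isCentral d
  refine ⟨inferInstance, fun x hx => ?_, hcen, hfin, ?_⟩
  · obtain ⟨u, rfl⟩ := FiniteDimensional.isUnit (HahnSeries d.ε.ker F) hx
    exact ⟨_, u.mul_inv, u.inv_mul⟩
  rintro ⟨M, hM, hfield, hgal⟩
  let := hfield.toField
  let := divisionRing d
  let j : M →ₐ[HahnSeries d.ε.ker F] MalcevNeumannRing d := M.val
  have hMfin : FiniteDimensional (HahnSeries d.ε.ker F) M :=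
    Module.Finite.of_injective j.toLinearMap Subtype.val_injective
  -- `M` is its own centralizer in an algebra of dimension `p ^ 4` over the centre.
  have hMdeg : Module.finrank (HahnSeries d.ε.ker F) M = p ^ 2 := by
    have h1 := finrank_eq_sq_of_centralizerOf_le (F := HahnSeries d.ε.ker F) (M := M) j (by
      refine le_trans (le_of_eq ?_)
        ((Subalgebra.centralizer_le_of_isMaximalCommutative hM).trans_eq M.range_val.symm)
      exact congrArg (Subalgebra.centralizer _) Subtype.range_val)
    rw [(finite_and_finrank_eq d).2, hA] at h1
    exact (Nat.pow_left_injective two_ne_zero h1).symm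
  have hinv : (subfieldVal j).IsInvariant (M ≃ₐ[HahnSeries d.ε.ker F] M) :=
    Valuation.isInvariant_comap_algHom (F := HahnSeries d.ε.ker F) j (orderVal d)
  have hk := isGalois_residue j (by
    rw [hMdeg, ← map_natCast (algebraMap F _), Nat.cast_pow]
    exact (map_ne_zero _).2 (pow_ne_zero _ hpF))
  obtain ⟨L, hρL, hιL, hL⟩ := exists_isGaloisField_of_commute (residueAlgHom j) ι fun x y =>
    (mem_centralizerOf_iff.1 (residueAlgHom_mem j x) y).symm
  -- Degree `p ^ 2` is excluded for the compositum of the residue field and `K`, so it equals `K`.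
  have heq := hL.eq_of_finrank_ne hp hA hιL
    (hK ▸ (AlgEquiv.ofInjectiveField ι).toLinearEquiv.finrank_eq.symm) (h L hιL hL)
  exact not_residueAlgHom_range_le j hp hK hpF hMdeg (heq ▸ hρL)

end MalcevNeumannRing

theorem theorem2p1 {F K A : Type*} [Field F] [Field K] [Algebra F K] [DivisionRing A] [Algebra F A]
    (p : ℕ) (hp : p.Prime) (hp2 : p ≠ 2)
    -- `A` is a central division `F`-algebra of degree `p ^ 2`
    [Algebra.IsCentral F A] (hA : Module.finrank F A = (p ^ 2) ^ 2)
    -- `K` is a Galois extension of `F` of degree `p` contained in `A`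
    [IsGalois F K] (hK : Module.finrank F K = p) (ι : K →ₐ[F] A)
    -- `v₁` and `v₂` are discrete valuations of `F`
    {Λ₁ Λ₂ Λ₁' Λ₂' : Type*}
    [LinearOrderedCommGroupWithZero Λ₁] [LinearOrderedCommGroupWithZero Λ₂]
    [LinearOrderedCommGroupWithZero Λ₁'] [LinearOrderedCommGroupWithZero Λ₂']
    (v₁ : Valuation F Λ₁) [v₁.IsRankOneDiscrete]
    (v₂ : Valuation F Λ₂) [v₂.IsRankOneDiscrete]
    -- (1) `w₁` and `w₂` are valuations of `A` extending `v₁` and `v₂`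
    (w₁ : Valuation A Λ₁') [v₁.HasExtension w₁]
    (w₂ : Valuation A Λ₂') [v₂.HasExtension w₂]
    -- (2)
    (h₁ : (w₁.comap (ι : K →+* A)).IsTotallyRamified F)
    (h₁p : ringChar v₁.Residue ≠ p)
    (h₁μ : ¬ ∃ ζ : v₁.Residue, IsPrimitiveRoot ζ (p ^ 2))
    -- (3)
    (h₂ : v₂.IsInertial (w₂.comap (ι : K →+* A)))
    [Finite v₂.Residue]
    (h₂0 : ¬ Nat.card v₂.Residue ≡ 0 [MOD p])
    (h₂1 : ¬ Nat.card v₂.Residue ≡ 1 [MOD p]) :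
    (¬ ∃ M : Subalgebra F A, M.IsMaximalSubfield ∧ ι.range ≤ M ∧ M.IsGaloisField) ∧
    ∀ (Γ : Type*) [AddCommGroup Γ] [LinearOrder Γ] [IsOrderedAddMonoid Γ]
      (d : MalcevNeumannDatum ι Γ),
      IsNoncrossedProductDivisionAlgebra (HahnSeries d.ε.ker F) (MalcevNeumannRing d) := by
  have hAfin : FiniteDimensional F A := .of_finrank_pos (hA ▸ pow_pos (pow_pos hp.pos 2) 2)
  have h₁p' := v₁.natCast_residue_ne_zero_of_ringChar hp h₁p
  -- Stated for every Galois subfield containing `K`, since the second assertion applies it to a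
  -- compositum not known to be maximal.
  have key (L : Subalgebra F A) (hιL : ι.range ≤ L) (hL : L.IsGaloisField) :
      Module.finrank F L ≠ p ^ 2 := by
    obtain ⟨hfield, hgal⟩ := hL
    let := hfield.toField
    exact not_exists_galois_of_valuations (M := L) hp hK ι v₁ v₂ w₁ w₂ h₁ h₁p' h₁μ
      (natCast_ne_zero_of_card hp h₂0) h₂1 L.val (hιL.trans_eq L.range_val.symm)
  refine ⟨?_, fun Γ _ _ _ d => MalcevNeumannRing.isNoncrossedProductDivisionAlgebra d hp hA hK
    (v₁.natCast_ne_zero h₁p') key⟩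
  rintro ⟨M, hM, hιM, hgalM⟩
  refine key M hιM hgalM ?_
  obtain ⟨hfield, hgal⟩ := hgalM
  let := hfield.toField
  have h := finrank_eq_sq_of_centralizerOf_le (F := F) (M := M) M.val (by
    refine le_trans (le_of_eq ?_) ((Subalgebra.centralizer_le_of_isMaximalCommutative
      hM.isMaximalCommutative).trans_eq M.range_val.symm)
    exact congrArg (Subalgebra.centralizer _) Subtype.range_val)
  rw [hA] at h
  exact (Nat.pow_left_injective two_ne_zero h).symm
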